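/- Let $\mathcal T=\mathbb R^d$ or $\mathcal T=\mathbb Z^d$ with $d\ge 1$, with its Borel $\sigma$-field. Let $\mathcal F$ be the set of functions $f:\mathcal T\to[-\infty,\infty)$ other than $f\equiv-\infty$, with the $\sigma$-field generated by all evaluation maps, and let $L^hf(t)=f(t-h)$. Let $Z=(Z(t))_{t\in\mathcal T}$ be a random process with paths in $\mathcal F$ such that $\mathbb E[e^{Z(t)}]=1$ and $\mathbb P\{Z(t)>-\infty\}=1$ for all $t\in\mathcal T$, and let $$\zeta_Z(t)=\max_{i\ge1}\bigl(P_i+Z_i(t)\bigr),\qquad t\in\mathcal T,$$ where $P_1,P_2,\dots$ are the points of a Poisson point process on $\mathbb R$ with intensity $e^{-x}\,dx$ and the $Z_i$ are independent copies of $Z$, independent of $(P_i)_{i\ge 1}$ (so $\zeta_Z$ is max-stable with unit Gumbel marginals). For $h\in\mathcal T$ let $Z^{[h]}$ be a process with law $\mathbb P\{Z^{[h]}\in A\}=\mathbb E[e^{Z(h)}\mathbf 1\{Z\in A\}]$, and put $\Xi_hZ(t)=Z^{[h]}(t)-Z^{[h]}(h)$, so that $L^b\Xi_aZ(t)=Z^{[a]}(t-b)-Z^{[a]}(a)$.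 Write $\stackrel{fdd}{=}$ for equality of all finite-dimensional distributions. Then the following are equivalent. (a) $\zeta_Z$ is stationary: $\zeta_Z\stackrel{fdd}{=}L^h\zeta_Z$ for all $h\in\mathcal T$. (b) For every $\sigma$-finite measure $\mu$ on $\mathcal T$ such that $\mathcal S_Z=\int_{\mathcal T}e^{Z(s)}\,\mu(ds)$ is an almost surely positive and finite random variable, $$\zeta_Z(t)\stackrel{fdd}{=}\max_{i\ge1}\Bigl(P_i+L^{T_i}Y_i(t)-\ln\int_{\mathcal T}e^{L^{T_i}Y_i(s)}\,\mu(ds)\Bigr),\qquad t\in\mathcal T,$$ where $(P_i,T_i)_{i\ge1}$ are the points of a Poisson point process on $\mathbb R\times\mathcal T$ with intensity $e^{-p}\,dp\cdot\mu(dt)$ and the $Y_i$ are independent copies of $\Xi_0Z$, independent of $(P_i,T_i)_{i\ge1}$. Here $\mathcal S_Z$ being a random variable means that $(s,\omega)\mapsto Z(s,\omega)$ is $\mu\otimes\mathbb P$-measurable. The copies are $Y_i=V(x_i)$, where $V$ is any process on a probability space $(E,Q)$ with $V\stackrel{fdd}{=}\Xi_0Z$, and the $x_i$ are independent random elements of $E$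 with law $Q$, independent of $(P_i,T_i)_{i\ge1}$; $V$ is such that $(h,e)\mapsto V(e)(t-h)$, for each $t$, and $(s,h,e)\mapsto V(e)(s-h)$ are measurable with respect to the completions of $\mu\otimes Q$ and $\mu\otimes\mu\otimes Q$ (which holds whenever $V$ is jointly measurable). (c) For every measurable $\Gamma:\mathcal F\to[0,\infty)$ with $\Gamma(f+c)=\Gamma(f)$ for all $f\in\mathcal F$, $c\in\mathbb R$, $$\mathbb E\bigl[e^{Z(a+h)}\Gamma(Z)\bigr]=\mathbb E\bigl[e^{Z(a)}\Gamma(L^hZ)\bigr]\quad\text{in }[0,\infty],\qquad a,h\in\mathcal T.$$ (d) $\Xi_{a+h}Z\stackrel{fdd}{=}L^h\Xi_aZ$ for all $a,h\in\mathcal T$. -/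

import Mathlib

open MeasureTheory ProbabilityTheory
open scoped ENNReal NNReal

universe u v

namespace MaxStable

/-- The set of functions on `T` with values in `[-∞, ∞)`, without the function `-∞`. Its
`σ`-field is the one generated by all the evaluation maps (the trace of the product `σ`-field). -/
def PathSpace (T : Type*) : Type _ :=
  {f : T → EReal // (∀ t, f t ≠ ⊤) ∧ ∃ t, f t ≠ ⊥}

instance {T : Type*} : CoeFun (PathSpace T) (fun _ => T → EReal) := ⟨Subtype.val⟩

instance {T : Type*} : MeasurableSpace (PathSpace T) :=
  inferInstanceAs (MeasurableSpace {f : T → EReal // (∀ t, f t ≠ ⊤) ∧ ∃ t, f t ≠ ⊥})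

/-- The lag operator, `(L^h f)(t) = f (t - h)`. -/
def PathSpace.lag {T : Type*} [AddGroup T] (h : T) (f : PathSpace T) : PathSpace T :=
  ⟨fun t => f (t - h), fun t => f.2.1 (t - h), by
    obtain ⟨t, ht⟩ := f.2.2
    exact ⟨t + h, by simpa using ht⟩⟩

/-- The function `f + c`, for a real constant `c`. -/
noncomputable def PathSpace.addConst {T : Type*} (f : PathSpace T) (c : ℝ) : PathSpace T :=
  ⟨fun t => f t + (c : EReal),
    fun t => (EReal.add_lt_top (f.2.1 t) (EReal.coe_ne_top c)).ne, by
    obtain ⟨t, ht⟩ := f.2.2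
    exact ⟨t, by simpa [EReal.add_eq_bot_iff] using ht⟩⟩

/-- Equality of all finite dimensional distributions of the process `X` under `P` and the
process `Y` under `Q`. -/
def FddEq {T A B : Type*} [MeasurableSpace A] [MeasurableSpace B]
    (X : A → T → EReal) (P : Measure A) (Y : B → T → EReal) (Q : Measure B) : Prop :=
  ∀ (n : ℕ) (t : Fin n → T),
    P.map (fun a (i : Fin n) => X a (t i)) = Q.map (fun b (i : Fin n) => Y b (t i))

/-- The number of points `p 0, p 1, …` that lie in `A`, with multiplicity. -/
noncomputable def pointCount {S : Type*} (p : ℕ → S) (A : Set S) : ℝ≥0∞ :=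
  ∑' i, A.indicator (fun _ => 1) (p i)

/-- The random points `p 0, p 1, …` are the points of a Poisson point process with intensity
measure `ν`: the number of points in a set of finite intensity is Poisson distributed, and the
numbers of points in disjoint sets are independent. -/
structure IsPoissonProcess {S Ω : Type*} [MeasurableSpace S] [MeasurableSpace Ω]
    (ν : Measure S) (p : ℕ → Ω → S) (P : Measure Ω) : Prop where
  measurable_point : ∀ i, Measurable (p i)
  map_count : ∀ A : Set S, MeasurableSet A → ν A ≠ ∞ →
    P.map (fun ω => pointCount (fun i => p i ω) A) =
      (poissonMeasure (ν A).toNNReal).map (fun k : ℕ => (k : ℝ≥0∞))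
  indep_count : ∀ (n : ℕ) (A : Fin n → Set S), (∀ k, MeasurableSet (A k)) →
    (∀ k l, k ≠ l → Disjoint (A k) (A l)) →
    iIndepFun (fun k ω => pointCount (fun i => p i ω) (A k)) P

/-- The points `p i` form a Poisson point process with intensity `ν`, the `x i` are independent
random elements with law `Q`, and the sequence `x` is independent of the sequence `p`. -/
structure IsMarkedPoisson {S M Ω : Type*} [MeasurableSpace S] [MeasurableSpace M]
    [MeasurableSpace Ω] (ν : Measure S) (Q : Measure M) (p : ℕ → Ω → S) (x : ℕ → Ω → M)
    (P : Measure Ω) : Prop where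
  poisson : IsPoissonProcess ν p P
  measurable_mark : ∀ i, Measurable (x i)
  map_mark : ∀ i, P.map (x i) = Q
  indep_mark : iIndepFun x P
  indep : IndepFun (fun ω i => p i ω) (fun ω i => x i ω) P

/-- The measure `e^{-x} dx` on the real line. -/
noncomputable def expIntensity : Measure ℝ :=
  (volume : Measure ℝ).withDensity (fun x => ENNReal.ofReal (Real.exp (-x)))

/-- The process `t ↦ max_i (p_i + z_i(t))`. -/
noncomputable def maxProcess {T Ω : Type*} (p : ℕ → Ω → ℝ) (z : ℕ → Ω → T → EReal) :
    Ω → T → EReal :=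
  fun ω t => ⨆ i, ((p i ω : EReal) + z i ω t)

/-- The exponential tilt of `P` by `Z(h)`. Under this measure the process `Z` is a realization of
`Z^{[h]}`, that is, it has the law `A ↦ E[e^{Z(h)} 1{Z ∈ A}]`. -/
noncomputable def tilt {T Ω : Type*} [MeasurableSpace Ω] (P : Measure Ω)
    (Z : Ω → PathSpace T) (h : T) : Measure Ω :=
  P.withDensity (fun ω => EReal.exp (Z ω h))

/-- The process `t ↦ Z(t) - Z(h)`. Under `tilt P Z h` this is the tilted spectral process
`Ξ_h Z(t) = Z^{[h]}(t) - Z^{[h]}(h)`. -/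
noncomputable def tiltedProcess {T Ω : Type*} (Z : Ω → PathSpace T) (h : T) : Ω → T → EReal :=
  fun ω t => Z ω t - Z ω h

/-- The measurability of a process `V` (automatic if `V` is jointly measurable and subtraction in
`T` is measurable) under which its values, and its integrals with respect to `μ`, after a shift by
an independent random time with law absolutely continuous to `μ` are random variables. -/
structure IsShiftMeasurable {T E : Type*} [AddGroup T] [MeasurableSpace T] [MeasurableSpace E]
    (V : E → T → EReal) (μ : Measure T) (Q : Measure E) : Prop where
  eval : ∀ t, AEMeasurable (fun q : T × E => V q.2 (t - q.1)) (μ.prod Q)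
  integrand : AEMeasurable (fun q : T × (T × E) => V q.2.2 (q.1 - q.2.1)) (μ.prod (μ.prod Q))

/-- The process `t ↦ Y(t) - ln ∫ e^{Y(s)} μ(ds)`. -/
noncomputable def logNormalize {T Ω : Type*} [MeasurableSpace T] (μ : Measure T)
    (Y : Ω → T → EReal) : Ω → T → EReal :=
  fun ω t => Y ω t - ENNReal.log (∫⁻ s, EReal.exp (Y ω s) ∂μ)

end MaxStable

open MaxStable

/-!
The four conditions are compared through the exponent function
`c ↦ E[max_j exp (Z(t_j) - c_j)]`.

For a Poisson process with intensity `ν`, `E[exp (-∑ f(p_i))] = exp (-∫ (1 - exp (-f)) dν)`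
(`IsPoissonProcess.laplace`); applied to `f(s) = -ln Q(x : (s, x) ∉ G)` it shows that no marked
point lies in `G` with probability `exp (-(ν ⊗ Q)(G))`
(`IsMarkedPoisson.measure_forall_notMem`). With the intensity `e^{-p} dp`, this makes the
distribution function of a max-process `max_i (p_i + w_j(T_i, x_i))` at `c` equal to
`exp (-∫ max_j exp (w_j - c_j))` (`IsMarkedPoisson.aemeasurable_max_and_measure_max_le`). Hence
stationarity is shift invariance of the exponent function, and the representation of `ζ` by
randomly shifted copies of `V`, for a given `μ`, says that the exponent function is
`∫ μ(db) E[max_j exp (V(t_j - b) - c_j) / ∫ exp (V(s - b)) μ(ds)]`.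

* Stationarity gives the tilting property: the right derivative at `r = 1` of
  `r ↦ E[max (r e^{Z(a)}, max_j e^{Z(t_j) - c_j})]` is
  `E[e^{Z(a)}; Z(t_j) - Z(a) ≤ c_j for all j]` (`tendsto_lintegral_max_sub`), so the exponent
  function determines the law of `Z - Z(a)` under the tilted measure.
* The tilting property and the tilt-shift formula are equivalent because a measurable functional
  of a path that is invariant under adding constants is a measurable function of `Z - Z(a)`, whose
  law is determined by its finite-dimensional distributions.
* The tilting property gives the representation: it makes `V(· - b)` a version of `Z - Z(b)` under
  the tilt at `b`. Although path integrals are not functions of finitely many coordinates,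
  `E[Φ(X) (∫ e^{X(s)} μ(ds))⁻¹]` depends only on the finite-dimensional distributions of `X`
  (`FddEq.lintegral_mul_inv_lintegral_exp`), so `V` can be exchanged for `Z`, after which Tonelli's
  theorem cancels the factor `∫ e^{Z(s)} μ(ds)`.
* The representation for the unit masses `δ_b`, realized on a product space that carries the given
  points and independent marks, expresses the exponent function at times `t_j` by a function of
  the times `t_j - b`, the same for every `b`, and this gives stationarity.
-/

namespace MaxStable
open Filter Topology

/-! ### The exponential function on `[0, ∞]` -/

/-- The decreasing bijection `x ↦ e^{-x}` from `[0, ∞]` to `[0, 1]`. -/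
noncomputable def expNeg (x : ℝ≥0∞) : ℝ≥0∞ := EReal.exp (-(x : EReal))

lemma expNeg_eq_inv (x : ℝ≥0∞) : expNeg x = (EReal.exp x)⁻¹ := EReal.exp_neg _

@[simp] lemma expNeg_zero : expNeg 0 = 1 := by simp [expNeg]

@[simp] lemma expNeg_top : expNeg ∞ = 0 := by simp [expNeg]

lemma expNeg_ofReal {x : ℝ} (hx : 0 ≤ x) :
    expNeg (ENNReal.ofReal x) = ENNReal.ofReal (Real.exp (-x)) := by
  rw [expNeg, EReal.coe_ennreal_ofReal, max_eq_left hx, ← EReal.coe_neg, EReal.exp_coe]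

lemma expNeg_strictAnti : StrictAnti expNeg := fun _ _ h =>
  EReal.exp_strictMono (EReal.neg_lt_neg_iff.2 (EReal.coe_ennreal_lt_coe_ennreal_iff.2 h))

lemma expNeg_le_one (x : ℝ≥0∞) : expNeg x ≤ 1 :=
  expNeg_zero ▸ expNeg_strictAnti.antitone zero_le


lemma continuous_expNeg : Continuous expNeg :=
  ENNReal.continuous_exp.comp (continuous_neg.comp continuous_coe_ennreal_ereal)

lemma measurable_expNeg : Measurable expNeg := continuous_expNeg.measurable

lemma expNeg_add (x y : ℝ≥0∞) : expNeg (x + y) = expNeg x * expNeg y := by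
  have h1 : ∀ x : ℝ≥0∞, EReal.exp (x : EReal) ≠ 0 := fun x => by simp
  rw [expNeg_eq_inv, expNeg_eq_inv, expNeg_eq_inv, EReal.coe_ennreal_add, EReal.exp_add,
    ENNReal.mul_inv (Or.inl (h1 x)) (Or.inr (h1 y))]

lemma expNeg_sum {ι : Type*} (s : Finset ι) (f : ι → ℝ≥0∞) :
    expNeg (∑ i ∈ s, f i) = ∏ i ∈ s, expNeg (f i) := by
  classical
  induction s using Finset.induction_on with
  | empty => simp
  | insert a s ha ih => rw [Finset.sum_insert ha, Finset.prod_insert ha, expNeg_add, ih]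

/-- The function `u ↦ -ln u`, an inverse of `expNeg` on `[0, 1]`; it is `0` for `u ≥ 1`. -/
noncomputable def negLog (u : ℝ≥0∞) : ℝ≥0∞ := (-(ENNReal.log u)).toENNReal

lemma measurable_negLog : Measurable negLog :=
  (continuous_neg.comp ENNReal.continuous_log).measurable.ereal_toENNReal

lemma expNeg_negLog {u : ℝ≥0∞} (hu : u ≤ 1) : expNeg (negLog u) = u := by
  rw [expNeg, negLog, EReal.coe_toENNReal, neg_neg, ENNReal.exp_log]
  rw [EReal.neg_nonneg]
  simpa using hu

/-! ### The Laplace functional of a Poisson process and void probabilities -/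

lemma lintegral_expNeg_mul_poisson (r a : ℝ≥0) :
    ∫⁻ x, expNeg (a * x) ∂((poissonMeasure r).map (fun k : ℕ => (k : ℝ≥0∞))) =
      expNeg (r * (1 - expNeg a)) := by
  have key : ∀ n : ℕ, expNeg (a * (n : ℝ≥0∞)) = ENNReal.ofReal (Real.exp (-a) ^ n) := fun n => by
    rw [show (a * (n : ℝ≥0∞)) = ENNReal.ofReal (n * a) by
      rw [ENNReal.ofReal_mul (by positivity)]; simp [mul_comm], expNeg_ofReal (by positivity),
      ← Real.exp_nat_mul]
    ring_nf
  have ha : expNeg a = ENNReal.ofReal (Real.exp (-a)) := by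
    rw [← expNeg_ofReal a.coe_nonneg, ENNReal.ofReal_coe_nnreal]
  have hle : Real.exp (-(a : ℝ)) ≤ 1 := by simp
  rw [lintegral_map (f := fun x => expNeg (a * x)) (measurable_expNeg.comp (by fun_prop))
    (by fun_prop), poissonMeasure,
    lintegral_sum_measure]
  simp_rw [lintegral_smul_measure, lintegral_dirac, key, smul_eq_mul]
  rw [ha, ← ENNReal.ofReal_one, ← ENNReal.ofReal_sub _ (by positivity),
    ← ENNReal.ofReal_coe_nnreal (p := r), ← ENNReal.ofReal_mul r.coe_nonneg,
    expNeg_ofReal (mul_nonneg r.coe_nonneg (by linarith))]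
  have hs : HasSum (fun n : ℕ => Real.exp (-r) * r ^ n / n.factorial * Real.exp (-a) ^ n)
      (Real.exp (-(r * (1 - Real.exp (-a))))) := by
    have := (NormedSpace.expSeries_div_hasSum_exp ((r : ℝ) * Real.exp (-a))).mul_left
      (Real.exp (-r))
    rw [← Real.exp_eq_exp_ℝ, ← Real.exp_add] at this
    convert! this using 1
    · ext n; rw [mul_pow]; ring
    · ring_nf
  rw [← hs.tsum_eq, ENNReal.ofReal_tsum_of_nonneg (fun n => by positivity) hs.summable]
  refine tsum_congr fun n => ?_
  rw [ENNReal.ofReal_mul (by positivity)]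

section Poisson

variable {S Ω : Type*} [MeasurableSpace S] [MeasurableSpace Ω] {ν : Measure S} {p : ℕ → Ω → S}
  {P : Measure Ω}

lemma IsPoissonProcess.measurable_pointCount (hp : IsPoissonProcess ν p P) {A : Set S}
    (hA : MeasurableSet A) : Measurable (fun ω => pointCount (fun i => p i ω) A) :=
  Measurable.tsum fun i => (measurable_const.indicator hA).comp (hp.measurable_point i)

lemma IsPoissonProcess.lintegral_expNeg_sum_pointCount (hp : IsPoissonProcess ν p P) {n : ℕ}
    (A : Fin n → Set S) (a : Fin n → ℝ≥0) (hA : ∀ k, MeasurableSet (A k))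
    (hd : ∀ k l, k ≠ l → Disjoint (A k) (A l)) (hf : ∀ k, ν (A k) ≠ ∞) :
    ∫⁻ ω, expNeg (∑ k, a k * pointCount (fun i => p i ω) (A k)) ∂P =
      expNeg (∑ k, ν (A k) * (1 - expNeg (a k))) := by
  simp_rw [expNeg_sum]
  rw [lintegral_prod_eq_prod_lintegral_of_indepFun Finset.univ
    (fun k ω => expNeg (a k * pointCount (fun i => p i ω) (A k)))
    ((hp.indep_count n A hA hd).comp (fun k x => expNeg (a k * x))
      fun k => measurable_expNeg.comp (by fun_prop))
    fun k => measurable_expNeg.comp ((hp.measurable_pointCount (hA k)).const_mul _)]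
  refine Finset.prod_congr rfl fun k _ => ?_
  rw [← lintegral_map (f := fun x => expNeg (a k * x)) (measurable_expNeg.comp (by fun_prop))
    (hp.measurable_pointCount (hA k)), hp.map_count _ (hA k) (hf k), lintegral_expNeg_mul_poisson,
    ENNReal.coe_toNNReal (hf k)]

/-- The Laplace functional at a simple function whose support has finite intensity: the level sets
are disjoint, and their counts are independent Poisson variables. -/
lemma IsPoissonProcess.laplace_simpleFunc (hp : IsPoissonProcess ν p P) (f : SimpleFunc S ℝ≥0)
    (hf : ν (f ⁻¹' {0}ᶜ) ≠ ∞) :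
    ∫⁻ ω, expNeg (∑' i, f (p i ω)) ∂P = expNeg (∫⁻ s, (1 - expNeg (f s)) ∂ν) := by
  classical
  set R : Finset ℝ≥0 := f.range.filter (· ≠ 0)
  let e : R ≃ Fin R.card := R.equivFin
  let a : Fin R.card → ℝ≥0 := fun k => (e.symm k : ℝ≥0)
  have hainj : Function.Injective a := Subtype.val_injective.comp e.symm.injective
  have ha0 : ∀ k, a k ≠ 0 := fun k => (Finset.mem_filter.1 (e.symm k).2).2
  let A : Fin R.card → Set S := fun k => f ⁻¹' {a k}
  have hA : ∀ k, MeasurableSet (A k) := fun k => f.measurableSet_preimage _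
  have hd : ∀ k l, k ≠ l → Disjoint (A k) (A l) := fun k l hkl =>
    Disjoint.preimage _ (Set.disjoint_singleton.2 (hainj.ne hkl))
  have hfin : ∀ k, ν (A k) ≠ ∞ := fun k => ne_top_of_le_ne_top hf
    (measure_mono (Set.preimage_mono (by simpa using (ha0 k).symm)))
  -- every function of `f` that vanishes where `f = 0` is a combination of the level sets
  have expand : ∀ (φ : ℝ≥0 → ℝ≥0∞), φ 0 = 0 → ∀ s,
      φ (f s) = ∑ k, φ (a k) * (A k).indicator (fun _ => 1) s := by
    intro φ h0 s
    by_cases hs : f s = 0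
    · rw [hs, h0]
      refine (Finset.sum_eq_zero fun k _ => ?_).symm
      rw [Set.indicator_of_notMem, mul_zero]
      exact fun h => ha0 k (by rw [← show f s = a k from h, hs])
    · have hmem : f s ∈ R := Finset.mem_filter.2 ⟨f.mem_range_self s, hs⟩
      rw [Finset.sum_eq_single (e ⟨f s, hmem⟩)]
      · have : a (e ⟨f s, hmem⟩) = f s := by simp [a]
        rw [Set.indicator_of_mem (show s ∈ A _ from this.symm), this, mul_one]
      · intro k _ hk
        rw [Set.indicator_of_notMem, mul_zero]
        intro h
        apply hk
        rw [← e.symm.injective.eq_iff, e.symm_apply_apply]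
        exact Subtype.ext (show f s = a k from h).symm
      · simp
  have h1 : ∀ ω, ∑' i, (f (p i ω) : ℝ≥0∞) =
      ∑ k, (a k : ℝ≥0∞) * pointCount (fun i => p i ω) (A k) := fun ω => by
    simp_rw [expand (fun x => (x : ℝ≥0∞)) rfl, pointCount, ← ENNReal.tsum_mul_left]
    exact Summable.tsum_finsetSum fun _ _ => ENNReal.summable
  simp_rw [h1]
  rw [hp.lintegral_expNeg_sum_pointCount A a hA hd hfin]
  congr 1
  simp_rw [expand (fun x => 1 - expNeg x) (by simp)]
  rw [lintegral_finsetSum _ fun k _ => (measurable_const.indicator (hA k)).const_mul _]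
  refine Finset.sum_congr rfl fun k _ => ?_
  rw [lintegral_const_mul _ (measurable_const.indicator (hA k)), lintegral_indicator_const (hA k),
    one_mul, mul_comm]

/-- The Laplace functional of a Poisson process. -/
lemma IsPoissonProcess.laplace [SigmaFinite ν] [IsProbabilityMeasure P]
    (hp : IsPoissonProcess ν p P) {f : S → ℝ≥0∞}
    (hf : Measurable f) :
    ∫⁻ ω, expNeg (∑' i, f (p i ω)) ∂P = expNeg (∫⁻ s, (1 - expNeg (f s)) ∂ν) := by
  let g : ℕ → SimpleFunc S ℝ≥0 := fun n =>
    ((SimpleFunc.eapprox f n).map ENNReal.toNNReal).restrict (spanningSets ν n)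
  have hg : ∀ n s, (g n s : ℝ≥0∞) =
      (spanningSets ν n).indicator (SimpleFunc.eapprox f n) s := by
    intro n s
    simp only [g, SimpleFunc.restrict_apply _ (measurableSet_spanningSets ν n)]
    by_cases hs : s ∈ spanningSets ν n
    · simp [hs, ENNReal.coe_toNNReal (SimpleFunc.eapprox_lt_top f n s).ne]
    · simp [hs]
  have hmono : ∀ s, Monotone fun n => (g n s : ℝ≥0∞) := fun s m n hmn => by
    simp only [hg]
    exact (Set.indicator_le_indicator_of_subset (monotone_spanningSets ν hmn)
      (fun _ => zero_le) s).trans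
      (Set.indicator_le_indicator (SimpleFunc.monotone_eapprox f hmn s))
  have hlim : ∀ s, Tendsto (fun n => (g n s : ℝ≥0∞)) atTop (𝓝 (f s)) := fun s => by
    refine (SimpleFunc.tendsto_eapprox hf s).congr' ?_
    filter_upwards [eventually_ge_atTop (spanningSetsIndex ν s)] with n hn
    rw [hg, Set.indicator_of_mem]
    exact monotone_spanningSets ν hn (mem_spanningSetsIndex ν s)
  have hfin : ∀ n, ν (g n ⁻¹' {0}ᶜ) ≠ ∞ := fun n => by
    refine ne_top_of_le_ne_top (measure_spanningSets_lt_top ν n).ne (measure_mono fun s hs => ?_)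
    by_contra h
    exact hs (by simpa [h] using hg n s)
  have hsum : ∀ ω, Tendsto (fun n => ∑' i, (g n (p i ω) : ℝ≥0∞)) atTop (𝓝 (∑' i, f (p i ω))) := by
    intro ω
    simp_rw [← lintegral_count]
    exact lintegral_tendsto_of_tendsto_of_monotone (fun n => measurable_from_top.aemeasurable)
      (ae_of_all _ fun i => hmono (p i ω)) (ae_of_all _ fun i => hlim (p i ω))
  have hgm : ∀ n, Measurable fun s => (g n s : ℝ≥0∞) := fun n =>
    measurable_coe_nnreal_ennreal.comp (g n).measurable
  have hL : Tendsto (fun n => ∫⁻ ω, expNeg (∑' i, (g n (p i ω) : ℝ≥0∞)) ∂P) atTop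
      (𝓝 (∫⁻ ω, expNeg (∑' i, f (p i ω)) ∂P)) := by
    refine tendsto_lintegral_of_dominated_convergence (fun _ => 1)
      (fun n => measurable_expNeg.comp (Measurable.tsum fun i =>
        (hgm n).comp (hp.measurable_point i)))
      (fun n => ae_of_all _ fun ω => expNeg_le_one _) (by simp) (ae_of_all _ fun ω => ?_)
    exact (continuous_expNeg.tendsto _).comp (hsum ω)
  have hR : Tendsto (fun n => expNeg (∫⁻ s, (1 - expNeg (g n s)) ∂ν)) atTop
      (𝓝 (expNeg (∫⁻ s, (1 - expNeg (f s)) ∂ν))) := by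
    refine (continuous_expNeg.tendsto _).comp ?_
    refine lintegral_tendsto_of_tendsto_of_monotone
      (fun n => (measurable_const.sub (measurable_expNeg.comp (hgm n))).aemeasurable)
      (ae_of_all _ fun s m n hmn => tsub_le_tsub_left (expNeg_strictAnti.antitone (hmono s hmn)) _)
      (ae_of_all _ fun s => ?_)
    exact ENNReal.Tendsto.sub tendsto_const_nhds ((continuous_expNeg.tendsto _).comp (hlim s))
      (Or.inl ENNReal.one_ne_top)
  refine tendsto_nhds_unique hL (hR.congr fun n => ?_)
  rw [hp.laplace_simpleFunc (g n) (hfin n)]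

variable {M : Type*} [MeasurableSpace M] {Q : Measure M} {x : ℕ → Ω → M}

/-- The probability that no marked point lies in `G`. Given the points, the marks avoid `G` with
probability `∏ i, Q {m | (p i, m) ∉ G}`, which is `expNeg` of a sum over the points. -/
lemma IsMarkedPoisson.measure_forall_notMem [SigmaFinite ν] [IsProbabilityMeasure P]
    [IsProbabilityMeasure Q] (h : IsMarkedPoisson ν Q p x P) {G : Set (S × M)}
    (hG : MeasurableSet G) :
    P {ω | ∀ i, (p i ω, x i ω) ∉ G} = expNeg ((ν.prod Q) G) := by
  have hxm : Measurable fun ω i => x i ω := measurable_pi_lambda _ h.measurable_mark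
  have hpm : Measurable fun ω i => p i ω := measurable_pi_lambda _ h.poisson.measurable_point
  have hxlaw : P.map (fun ω i => x i ω) = Measure.infinitePi fun _ => Q := by
    rw [h.indep_mark.map_fun_eq_infinitePi_map h.measurable_mark]
    simp_rw [h.map_mark]
  have hjoint := (indepFun_iff_map_prod_eq_prod_map_map hpm.aemeasurable hxm.aemeasurable).1 h.indep
  let f : S → ℝ≥0∞ := fun s => negLog (Q (Prod.mk s ⁻¹' Gᶜ))
  have hfm : Measurable f := measurable_negLog.comp (measurable_measure_prodMk_left hG.compl)
  let H : Set ((ℕ → S) × (ℕ → M)) := {y | ∀ i, (y.1 i, y.2 i) ∉ G}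
  have hH : MeasurableSet H := by
    rw [show H = ⋂ i, (fun y : (ℕ → S) × (ℕ → M) => (y.1 i, y.2 i)) ⁻¹' Gᶜ by ext; simp [H]]
    refine MeasurableSet.iInter fun i => ?_
    have hm : Measurable fun y : (ℕ → S) × (ℕ → M) => (y.1 i, y.2 i) := by fun_prop
    exact hm hG.compl
  have hsec : ∀ s : ℕ → S, (Measure.infinitePi fun _ => Q) (Prod.mk s ⁻¹' H) =
      expNeg (∑' i, f (s i)) := by
    intro s
    have hbox : Prod.mk s ⁻¹' H = Set.pi Set.univ fun i => Prod.mk (s i) ⁻¹' Gᶜ := by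
      ext y; simp [H, Set.mem_pi]
    rw [hbox, Measure.infinitePi_pi_univ _ fun i => measurable_prodMk_left hG.compl]
    have h1 : ∀ i, Q (Prod.mk (s i) ⁻¹' Gᶜ) = expNeg (f (s i)) := fun i =>
      (expNeg_negLog prob_le_one).symm
    simp_rw [h1]
    refine HasProd.tprod_eq ?_
    have h2 := (continuous_expNeg.tendsto _).comp
      (ENNReal.summable (f := fun i => f (s i))).hasSum
    exact h2.congr fun t => expNeg_sum _ _
  have hmeas : P {ω | ∀ i, (p i ω, x i ω) ∉ G} =
      (P.map fun ω => (fun i => p i ω, fun i => x i ω)) H :=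
    (Measure.map_apply (hpm.prodMk hxm) hH).symm
  rw [hmeas, hjoint, Measure.prod_apply hH, hxlaw]
  simp_rw [hsec]
  rw [lintegral_map _ hpm]
  · rw [h.poisson.laplace hfm, Measure.prod_apply hG]
    congr 1
    refine lintegral_congr fun s => ?_
    rw [expNeg_negLog prob_le_one, Set.preimage_compl, prob_compl_eq_one_sub
      (measurable_prodMk_left hG), ENNReal.sub_sub_cancel ENNReal.one_ne_top prob_le_one]
  · exact measurable_expNeg.comp (Measurable.tsum fun i => hfm.comp (measurable_pi_apply i))

/-- Almost surely, all the marked points avoid a given null set of the intensity. -/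
lemma IsMarkedPoisson.ae_forall [SigmaFinite ν] [IsProbabilityMeasure P]
    [IsProbabilityMeasure Q] (h : IsMarkedPoisson ν Q p x P) {r : S × M → Prop}
    (hr : ∀ᵐ y ∂(ν.prod Q), r y) : ∀ᵐ ω ∂P, ∀ i, r (p i ω, x i ω) := by
  obtain ⟨G, hsub, hG, hG0⟩ := exists_measurable_superset_of_null (ae_iff.1 hr)
  have h1 := h.measure_forall_notMem hG
  rw [hG0, expNeg_zero] at h1
  have h2 : ∀ᵐ ω ∂P, ∀ i, (p i ω, x i ω) ∉ G := by
    rw [← mem_ae_iff_prob_eq_one] at h1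
    · exact h1
    · rw [Set.ofPred_forall]
      exact MeasurableSet.iInter fun i =>
        ((h.poisson.measurable_point i).prodMk (h.measurable_mark i)) hG.compl
  filter_upwards [h2] with ω hω i
  by_contra hc
  exact hω i (hsub hc)

end Poisson

/-! ### Distribution functions of max-processes -/

instance : SigmaFinite expIntensity :=
  SigmaFinite.withDensity_of_ne_top (ae_of_all _ fun _ => by simp)

lemma expIntensity_Ioi (a : ℝ) : expIntensity (Set.Ioi a) = ENNReal.ofReal (Real.exp (-a)) := by
  rw [expIntensity, withDensity_apply _ measurableSet_Ioi, ← integral_exp_neg_Ioi a,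
    ofReal_integral_eq_lintegral_ofReal (integrableOn_exp_neg_Ioi a)
      (ae_of_all _ fun x => (Real.exp_pos _).le)]

lemma expIntensity_univ : expIntensity Set.univ = ∞ := by
  refine ENNReal.eq_top_of_forall_nnreal_le fun r => ?_
  calc (r : ℝ≥0∞) ≤ ENNReal.ofReal (Real.exp (-(-(r : ℝ)))) := by
        rw [neg_neg, ← ENNReal.ofReal_coe_nnreal]
        exact ENNReal.ofReal_le_ofReal ((le_add_of_nonneg_right zero_le_one).trans
          (Real.add_one_le_exp _))
    _ = expIntensity (Set.Ioi (-(r : ℝ))) := (expIntensity_Ioi _).symm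
    _ ≤ _ := measure_mono (Set.subset_univ _)

/-- This holds for all values in `[-∞, ∞]`, with the conventions `⊤ + ⊥ = ⊥` and `exp ⊥ = 0`. -/
lemma expIntensity_setOf_lt_add (w c : EReal) :
    expIntensity {p : ℝ | c < p + w} = EReal.exp (w - c) := by
  induction w with
  | bot => simp
  | top =>
    by_cases hc : c = ⊤
    · simp [hc]
    · simp [EReal.top_sub hc, lt_top_iff_ne_top, hc, expIntensity_univ]
  | coe w =>
    induction c with
    | bot =>
      have : {p : ℝ | (⊥ : EReal) < p + w} = Set.univ := by
        ext p; simp [← EReal.coe_add]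
      rw [this, expIntensity_univ]; simp
    | top => simp
    | coe c =>
      have : {p : ℝ | (c : EReal) < p + w} = Set.Ioi (c - w) := by
        ext p
        simp only [Set.mem_ofPred_eq, Set.mem_Ioi, ← EReal.coe_add, EReal.coe_lt_coe_iff]
        exact sub_lt_iff_lt_add.symm
      rw [this, expIntensity_Ioi, ← EReal.coe_sub, EReal.exp_coe, neg_sub]

lemma expIntensity_setOf_exists_lt_add {n : ℕ} (w c : Fin n → EReal) :
    expIntensity {p : ℝ | ∃ j, c j < p + w j} = ⨆ j, EReal.exp (w j - c j) := by
  simp_rw [← expIntensity_setOf_lt_add]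
  have hup : ∀ j, IsUpperSet {p : ℝ | c j < p + w j} := fun j p q hpq hp =>
    lt_of_lt_of_le hp (add_le_add (EReal.coe_le_coe_iff.2 hpq) le_rfl)
  rw [← Directed.measure_iUnion]
  · congr 1; ext p; simp
  · intro i j
    rcases (hup i).total (hup j) with h | h
    · exact ⟨j, h, subset_rfl⟩
    · exact ⟨i, subset_rfl, h⟩

section

variable {T E Ω : Type*} [MeasurableSpace T] [MeasurableSpace E] [MeasurableSpace Ω]
  {μ : Measure T} [SigmaFinite μ] {Q : Measure E} [IsProbabilityMeasure Q] {P : Measure Ω}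
  [IsProbabilityMeasure P] {q : ℕ → Ω → ℝ × T} {x : ℕ → Ω → E}

/-- The distribution function of the vector `max_i (p_i + w_j(T_i, x_i))`. The functions `w j` are
only almost everywhere measurable: the marked points avoid the exceptional null sets. -/
lemma IsMarkedPoisson.aemeasurable_max_and_measure_max_le {n : ℕ}
    (hm : IsMarkedPoisson (expIntensity.prod μ) Q q x P)
    {w : Fin n → T × E → EReal} (hw : ∀ j, AEMeasurable (w j) (μ.prod Q)) :
    AEMeasurable (fun ω j => ⨆ i, (((q i ω).1 : EReal) + w j ((q i ω).2, x i ω))) P ∧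
    ∀ c : Fin n → EReal,
      P {ω | ∀ j, ⨆ i, (((q i ω).1 : EReal) + w j ((q i ω).2, x i ω)) ≤ c j} =
        expNeg (∫⁻ y, ⨆ j, EReal.exp (w j y - c j) ∂(μ.prod Q)) := by
  let w' : Fin n → T × E → EReal := fun j => (hw j).mk (w j)
  have hw' : ∀ j, Measurable (w' j) := fun j => (hw j).measurable_mk
  have hww : ∀ᵐ y ∂(μ.prod Q), ∀ j, w j y = w' j y := ae_all_iff.2 fun j => (hw j).ae_eq_mk
  have hassoc := measurePreserving_prodAssoc expIntensity μ Q
  have hlift : ∀ᵐ y ∂((expIntensity.prod μ).prod Q), ∀ j, w j (y.1.2, y.2) = w' j (y.1.2, y.2) :=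
    (Measure.quasiMeasurePreserving_snd.comp hassoc.quasiMeasurePreserving).ae hww
  have hae : ∀ᵐ ω ∂P, ∀ i j, w j ((q i ω).2, x i ω) = w' j ((q i ω).2, x i ω) :=
    hm.ae_forall hlift
  have hq := hm.poisson.measurable_point
  have hx := hm.measurable_mark
  refine ⟨⟨fun ω j => ⨆ i, (((q i ω).1 : EReal) + w' j ((q i ω).2, x i ω)), ?_, ?_⟩, fun c => ?_⟩
  · refine measurable_pi_lambda _ fun j => Measurable.iSup fun i => ?_
    exact (hq i).fst.coe_real_ereal.add ((hw' j).comp ((hq i).snd.prodMk (hx i)))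
  · filter_upwards [hae] with ω hω
    funext j
    exact iSup_congr fun i => by rw [hω i j]
  · let G : Set ((ℝ × T) × E) := {y | ∃ j, c j < (y.1.1 : EReal) + w' j (y.1.2, y.2)}
    let H : Set (ℝ × (T × E)) := {y | ∃ j, c j < (y.1 : EReal) + w' j y.2}
    have hH : MeasurableSet H := by
      rw [show H = ⋃ j, {y | c j < (y.1 : EReal) + w' j y.2} by ext; simp [H]]
      exact MeasurableSet.iUnion fun j => measurableSet_lt measurable_const
        (measurable_fst.coe_real_ereal.add ((hw' j).comp measurable_snd))
    have hG : MeasurableSet G := hassoc.measurable hH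
    have h1 := hm.measure_forall_notMem hG
    rw [show G = MeasurableEquiv.prodAssoc ⁻¹' H from rfl,
      hassoc.measure_preimage hH.nullMeasurableSet, Measure.prod_apply_symm hH] at h1
    have h2 : ∫⁻ y, ⨆ j, EReal.exp (w j y - c j) ∂(μ.prod Q) =
        ∫⁻ y, expIntensity ((fun p => (p, y)) ⁻¹' H) ∂(μ.prod Q) := by
      refine lintegral_congr_ae ?_
      filter_upwards [hww] with y hy
      simp_rw [hy]
      exact (expIntensity_setOf_exists_lt_add _ _).symm
    rw [h2, ← h1]
    refine measure_congr ?_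
    filter_upwards [hae] with ω hω
    refine propext ?_
    change (∀ j, ⨆ i, _ ≤ c j) ↔ ∀ i, ¬ ∃ j, _
    simp only [iSup_le_iff, not_exists, hω, not_lt]
    exact forall_comm

end

lemma generateFrom_Iic_ne_bot :
    MeasurableSpace.generateFrom (Set.Iic '' {c : EReal | c ≠ ⊥}) = EReal.measurableSpace := by
  have hb : EReal.measurableSpace = MeasurableSpace.generateFrom (Set.range Set.Iic) :=
    borel_eq_generateFrom_Iic EReal
  refine le_antisymm ?_ ?_
  · rw [hb]
    exact MeasurableSpace.generateFrom_mono (Set.image_subset_range _ _)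
  · rw [hb]
    refine MeasurableSpace.generateFrom_le ?_
    rintro _ ⟨c, rfl⟩
    have hreal : ∀ c : EReal, c ≠ ⊥ → @MeasurableSet EReal
        (MeasurableSpace.generateFrom (Set.Iic '' {c : EReal | c ≠ ⊥})) (Set.Iic c) :=
      fun c hc => MeasurableSpace.measurableSet_generateFrom ⟨c, hc, rfl⟩
    by_cases hc : c = ⊥
    · have : Set.Iic c = ⋂ n : ℕ, Set.Iic (((-(n : ℝ)) : ℝ) : EReal) := by
        ext y
        simp only [hc, Set.mem_Iic, le_bot_iff, Set.mem_iInter]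
        refine ⟨fun h n => h ▸ bot_le, fun h => ?_⟩
        refine EReal.eq_bot_iff_forall_lt y |>.2 fun r => ?_
        obtain ⟨n, hn⟩ := exists_nat_gt (-r)
        exact (h n).trans_lt (EReal.coe_lt_coe_iff.2 (by linarith))
      rw [this]
      exact MeasurableSet.iInter fun n => hreal _ (EReal.coe_ne_bot _)
    · exact hreal c hc

/-- The bounds `c j = ⊥` are left out because the exponent function may be infinite
there. -/
lemma ext_of_forall_le {n : ℕ} {μ ν : Measure (Fin n → EReal)} [IsFiniteMeasure μ]
    (h : ∀ c : Fin n → EReal, (∀ j, c j ≠ ⊥) →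
      μ {y | ∀ j, y j ≤ c j} = ν {y | ∀ j, y j ≤ c j}) : μ = ν := by
  have hpi : ∀ c : Fin n → EReal, {y : Fin n → EReal | ∀ j, y j ≤ c j} =
      Set.pi Set.univ fun j => Set.Iic (c j) := fun c => by ext; simp [Set.mem_pi, -Set.pi_univ_Iic]
  refine ext_of_generate_finite
    (Set.pi Set.univ '' Set.pi Set.univ fun _ : Fin n => Set.Iic '' {c : EReal | c ≠ ⊥})
    ?_ (IsPiSystem.pi fun _ => isPiSystem_image_Iic _) ?_ ?_
  · refine (generateFrom_eq_pi (fun _ => ?_) fun _ => ?_).symm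
    · exact generateFrom_Iic_ne_bot
    · exact ⟨fun _ => Set.univ, fun _ => ⟨⊤, by simp, Set.Iic_top⟩, Set.iUnion_const _⟩
  · rintro _ ⟨s, hs, rfl⟩
    choose c hc0 hc using fun j => hs j (Set.mem_univ j)
    obtain rfl : (fun j => Set.Iic (c j)) = s := funext hc
    rw [← hpi]
    exact h c hc0
  · simpa using h (fun _ => ⊤) (by simp)

lemma measurableSet_setOf_forall_le {n : ℕ} (c : Fin n → EReal) :
    MeasurableSet {y : Fin n → EReal | ∀ j, y j ≤ c j} := by
  rw [Set.ofPred_forall]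
  exact MeasurableSet.iInter fun j => measurableSet_le (measurable_pi_apply j) measurable_const

lemma map_eq_map_iff_of_expNeg {A B : Type*} [MeasurableSpace A] [MeasurableSpace B]
    {P : Measure A} {Q : Measure B} [IsFiniteMeasure P] {n : ℕ} {X : A → Fin n → EReal}
    {Y : B → Fin n → EReal} (hX : AEMeasurable X P) (hY : AEMeasurable Y Q)
    {F G : (Fin n → EReal) → ℝ≥0∞} (hF : ∀ c, P {a | ∀ j, X a j ≤ c j} = expNeg (F c))
    (hG : ∀ c, Q {b | ∀ j, Y b j ≤ c j} = expNeg (G c)) :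
    P.map X = Q.map Y ↔ ∀ c, F c = G c := by
  have h1 : ∀ c, P.map X {y | ∀ j, y j ≤ c j} = expNeg (F c) := fun c => by
    rw [Measure.map_apply_of_aemeasurable hX (measurableSet_setOf_forall_le c), ← hF]; rfl
  have h2 : ∀ c, Q.map Y {y | ∀ j, y j ≤ c j} = expNeg (G c) := fun c => by
    rw [Measure.map_apply_of_aemeasurable hY (measurableSet_setOf_forall_le c), ← hG]; rfl
  refine ⟨fun h c => expNeg_strictAnti.injective ?_, fun h => ext_of_forall_le fun c _ => ?_⟩
  · rw [← h1, h, h2]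
  · rw [h1, h2, h]

/-- A Poisson process is turned into one on `S × T`, all of whose points have second coordinate `h`.
The points may be replaced by any sequence `g` with the same joint law, on another probability
space. -/
lemma IsPoissonProcess.prodMk_dirac {S T Ω Ω' : Type*} [MeasurableSpace S] [MeasurableSpace T]
    [MeasurableSpace Ω] [MeasurableSpace Ω'] {ν : Measure S} [SFinite ν] {p : ℕ → Ω → S}
    {P : Measure Ω} [IsProbabilityMeasure P] (hp : IsPoissonProcess ν p P) {P' : Measure Ω'}
    [IsProbabilityMeasure P'] {g : Ω' → ℕ → S}
    (hg : Measurable g) (hlaw : P'.map g = P.map (fun ω i => p i ω)) (h : T) :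
    IsPoissonProcess (ν.prod (Measure.dirac h)) (fun i ω => (g ω i, h)) P' := by
  have hpm : Measurable fun ω i => p i ω := measurable_pi_lambda _ hp.measurable_point
  have hsec : ∀ A : Set (S × T), MeasurableSet A →
      (ν.prod (Measure.dirac h)) A = ν ((fun s => (s, h)) ⁻¹' A) := fun A hA => by
    rw [Measure.prod_apply_symm hA, lintegral_dirac' _ (measurable_measure_prodMk_right hA)]
  let N : Set (S × T) → (ℕ → S) → ℝ≥0∞ := fun A s => pointCount s ((fun s => (s, h)) ⁻¹' A)
  have hN : ∀ A, MeasurableSet A → Measurable (N A) := fun A hA =>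
    Measurable.tsum fun i => ((measurable_const.indicator
      ((measurable_prodMk_right (y := h)) hA))).comp (measurable_pi_apply i)
  have hcount : ∀ A ω, pointCount (fun i => (g ω i, h)) A = N A (g ω) := fun A ω => rfl
  refine ⟨fun i => ((measurable_pi_apply i).comp hg).prodMk measurable_const, fun A hA hfin => ?_,
    fun n A hA hd => ?_⟩
  · rw [hsec A hA] at hfin ⊢
    rw [← hp.map_count _ (measurable_prodMk_right hA) hfin]
    simp_rw [hcount]
    rw [← Function.comp_def (N A) g, ← Measure.map_map (hN A hA) hg, hlaw,
      Measure.map_map (hN A hA) hpm]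
    rfl
  · have h1 : iIndepFun (fun k ω => N (A k) fun i => p i ω) P :=
      hp.indep_count n (fun k => (fun s => (s, h)) ⁻¹' A k)
      (fun k => measurable_prodMk_right (hA k)) (fun k l hkl => (hd k l hkl).preimage _)
    have hNA : ∀ k, Measurable (N (A k)) := fun k => hN _ (hA k)
    have hNm : Measurable fun s k => N (A k) s := measurable_pi_lambda _ hNA
    have hmarg : ∀ k, P'.map (fun ω => N (A k) (g ω)) =
        P.map (fun ω => N (A k) fun i => p i ω) := fun k => by
      rw [← Function.comp_def (N (A k)) g, ← Measure.map_map (hNA k) hg, hlaw,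
        Measure.map_map (hNA k) hpm]
      rfl
    refine (iIndepFun_iff_map_fun_eq_infinitePi_map
      (X := fun k ω => N (A k) (g ω)) fun k => (hNA k).comp hg).2 ?_
    simp_rw [hmarg]
    refine Eq.trans ?_ ((iIndepFun_iff_map_fun_eq_infinitePi_map
      (X := fun k ω => N (A k) fun i => p i ω) fun k => (hNA k).comp hpm).1 h1)
    change P'.map ((fun s k => N (A k) s) ∘ g) =
      P.map ((fun s k => N (A k) s) ∘ fun ω i => p i ω)
    rw [← Measure.map_map hNm hg, hlaw, Measure.map_map hNm hpm]

/-! ### Path integrals and finite-dimensional distributions -/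

lemma _root_.AEMeasurable.ae_prodMk_left {A T γ : Type*} [MeasurableSpace A] [MeasurableSpace T]
    [MeasurableSpace γ] {P : Measure A} {μ : Measure T} [SFinite μ] {f : A × T → γ}
    (hf : AEMeasurable f (P.prod μ)) : ∀ᵐ a ∂P, AEMeasurable (fun t => f (a, t)) μ := by
  filter_upwards [Measure.ae_ae_of_ae_prod hf.ae_eq_mk] with a ha
  exact ⟨fun t => hf.mk f (a, t), hf.measurable_mk.comp measurable_prodMk_left, ha⟩

section

variable {T A B : Type*} [MeasurableSpace A] [MeasurableSpace B]
  {P : Measure A} {Q : Measure B} {X : A → T → EReal} {Y : B → T → EReal}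

lemma FddEq.lintegral_eq (h : FddEq X P Y Q) (hX : ∀ t, AEMeasurable (fun a => X a t) P)
    (hY : ∀ t, AEMeasurable (fun b => Y b t) Q) {n : ℕ} (t : Fin n → T)
    {Φ : (Fin n → EReal) → ℝ≥0∞} (hΦ : Measurable Φ) :
    ∫⁻ a, Φ (fun i => X a (t i)) ∂P = ∫⁻ b, Φ (fun i => Y b (t i)) ∂Q := by
  rw [← lintegral_map' (f := Φ) hΦ.aemeasurable (aemeasurable_pi_lambda _ fun i => hX (t i)),
    h n t, lintegral_map' hΦ.aemeasurable (aemeasurable_pi_lambda _ fun i => hY (t i))]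

variable [MeasurableSpace T]

/-- With `S = ∫ g(X(s)) μ(ds)` and `U = 1 - (ε + S)`, this is the expectation of
`Φ U^k = Φ U^{k+1} + ε Φ U^k + S Φ U^k`, where the integral in the last `S` is taken outside. -/
lemma lintegral_mul_one_sub_pow_succ {μ : Measure T} [SFinite μ] [SFinite P]
    (hXm : AEMeasurable (fun y : T × A => X y.2 y.1) (μ.prod P))
    {g : EReal → ℝ≥0∞} (hg : Measurable g) {ε : ℝ≥0∞}
    (hle : ∀ a, ε + ∫⁻ s, g (X a s) ∂μ ≤ 1) {Φ : A → ℝ≥0∞} (hΦ : AEMeasurable Φ P) (k : ℕ) :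
    ∫⁻ a, Φ a * (1 - (ε + ∫⁻ s, g (X a s) ∂μ)) ^ k ∂P =
      ∫⁻ a, Φ a * (1 - (ε + ∫⁻ s, g (X a s) ∂μ)) ^ (k + 1) ∂P +
      (ε * ∫⁻ a, Φ a * (1 - (ε + ∫⁻ s, g (X a s) ∂μ)) ^ k ∂P +
      ∫⁻ s, ∫⁻ a, (Φ a * g (X a s)) * (1 - (ε + ∫⁻ s, g (X a s) ∂μ)) ^ k ∂P ∂μ) := by
  set S : A → ℝ≥0∞ := fun a => ∫⁻ s, g (X a s) ∂μ
  have hgX : AEMeasurable (fun y : T × A => g (X y.2 y.1)) (μ.prod P) :=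
    hg.comp_aemeasurable hXm
  have hS : AEMeasurable S P := hgX.lintegral_prod_left'
  have hU : AEMeasurable (fun a => (1 - (ε + S a)) ^ k) P :=
    (aemeasurable_const.sub (aemeasurable_const.add hS)).pow_const k
  have hswap : ∫⁻ s, ∫⁻ a, (Φ a * g (X a s)) * (1 - (ε + S a)) ^ k ∂P ∂μ =
      ∫⁻ a, Φ a * (1 - (ε + S a)) ^ k * S a ∂P := by
    rw [lintegral_lintegral_swap]
    · refine lintegral_congr_ae ?_
      filter_upwards [hgX.prod_swap.ae_prodMk_left] with a ha
      have ha' : AEMeasurable (fun s => g (X a s)) μ := ha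
      rw [← lintegral_const_mul'' _ ha']
      exact lintegral_congr fun s => mul_right_comm _ _ _
    · exact ((hΦ.comp_snd).mul hgX).mul hU.comp_snd
  have hΦU : AEMeasurable (fun a => Φ a * (1 - (ε + S a)) ^ k) P := hΦ.mul hU
  have hΦU' : AEMeasurable (fun a => Φ a * (1 - (ε + S a)) ^ (k + 1)) P :=
    hΦ.mul ((aemeasurable_const.sub (aemeasurable_const.add hS)).pow_const (k + 1))
  change ∫⁻ a, Φ a * (1 - (ε + S a)) ^ k ∂P = ∫⁻ a, Φ a * (1 - (ε + S a)) ^ (k + 1) ∂P +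
    (ε * ∫⁻ a, Φ a * (1 - (ε + S a)) ^ k ∂P + _)
  rw [hswap, ← lintegral_const_mul'' _ hΦU, ← lintegral_add_left' (hΦU.const_mul _),
    ← lintegral_add_left' hΦU']
  refine lintegral_congr fun a => ?_
  have h1 : (1 : ℝ≥0∞) = (1 - (ε + S a)) + (ε + S a) := (tsub_add_cancel_of_le (hle a)).symm
  calc Φ a * (1 - (ε + S a)) ^ k
      = Φ a * (1 - (ε + S a)) ^ k * ((1 - (ε + S a)) + (ε + S a)) := by rw [← h1, mul_one]
    _ = _ := by ring

/-- `E[Φ(X(t)) (1 - ε - ∫ g(X(s)) μ(ds))^k]` depends only on the finite-dimensional distributions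
of `X`. In the induction on `k`, the factor `g(X(s))` is absorbed into `Φ`, as a function of the
additional coordinate `X(s)`. -/
lemma FddEq.lintegral_mul_one_sub_pow {μ : Measure T} [IsFiniteMeasure μ] [IsFiniteMeasure P]
    [IsFiniteMeasure Q] (h : FddEq X P Y Q)
    (hX : ∀ t, AEMeasurable (fun a => X a t) P) (hY : ∀ t, AEMeasurable (fun b => Y b t) Q)
    (hXm : AEMeasurable (fun y : T × A => X y.2 y.1) (μ.prod P))
    (hYm : AEMeasurable (fun y : T × B => Y y.2 y.1) (μ.prod Q))
    {g : EReal → ℝ≥0∞} (hg : Measurable g) {ε C : ℝ≥0∞} (hC : C ≠ ∞) (hgC : ∀ x, g x ≤ C)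
    (hεC : ε + C * μ Set.univ ≤ 1) (k : ℕ) :
    ∀ {n : ℕ} (t : Fin n → T) {Φ : (Fin n → EReal) → ℝ≥0∞} {K : ℝ≥0∞}, Measurable Φ → K ≠ ∞ →
      (∀ y, Φ y ≤ K) →
    ∫⁻ a, Φ (fun i => X a (t i)) * (1 - (ε + ∫⁻ s, g (X a s) ∂μ)) ^ k ∂P =
      ∫⁻ b, Φ (fun i => Y b (t i)) * (1 - (ε + ∫⁻ s, g (Y b s) ∂μ)) ^ k ∂Q := by
  have hle : ∀ x : T → EReal, ε + ∫⁻ s, g (x s) ∂μ ≤ 1 := fun x =>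
    (add_le_add le_rfl ((lintegral_mono fun s => hgC (x s)).trans_eq (lintegral_const C))).trans hεC
  induction k with
  | zero =>
    intro n t Φ K hΦ _ _
    simpa using h.lintegral_eq hX hY t hΦ
  | succ k ih =>
    intro n t Φ K hΦ hK hΦK
    have hΦX : AEMeasurable (fun a => Φ fun i => X a (t i)) P :=
      hΦ.comp_aemeasurable (aemeasurable_pi_lambda _ fun i => hX (t i))
    have hΦY : AEMeasurable (fun b => Φ fun i => Y b (t i)) Q :=
      hΦ.comp_aemeasurable (aemeasurable_pi_lambda _ fun i => hY (t i))
    have e1 := lintegral_mul_one_sub_pow_succ hXm hg (fun a => hle (X a)) hΦX k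
    have e2 := lintegral_mul_one_sub_pow_succ hYm hg (fun b => hle (Y b)) hΦY k
    have e3 : ∀ s : T, ∫⁻ a, (Φ (fun i => X a (t i)) * g (X a s)) *
          (1 - (ε + ∫⁻ s, g (X a s) ∂μ)) ^ k ∂P =
        ∫⁻ b, (Φ (fun i => Y b (t i)) * g (Y b s)) *
          (1 - (ε + ∫⁻ s, g (Y b s) ∂μ)) ^ k ∂Q := fun s => by
      have := ih (Fin.cons s t : Fin (n + 1) → T)
        (Φ := fun y => Φ (fun i => y i.succ) * g (y 0)) (K := K * C)
        ((hΦ.comp (by fun_prop)).mul (hg.comp (measurable_pi_apply 0)))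
        (ENNReal.mul_ne_top hK hC) (fun y => mul_le_mul' (hΦK _) (hgC _))
      simpa using this
    have e4 := ih t hΦ hK hΦK
    simp_rw [e3, e4] at e1
    have hfin : ∫⁻ b, Φ (fun i => Y b (t i)) * (1 - (ε + ∫⁻ s, g (Y b s) ∂μ)) ^ k ∂Q ≠ ∞ := by
      refine ne_top_of_le_ne_top (b := K * Q Set.univ)
        (ENNReal.mul_ne_top hK (measure_ne_top _ _)) ?_
      refine (lintegral_mono fun b => mul_le_mul' (hΦK _)
        (pow_le_one₀ (zero_le) tsub_le_self)).trans_eq ?_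
      simp only [mul_one, lintegral_const]
    rw [e1] at hfin
    exact (ENNReal.add_left_inj (ne_top_of_le_ne_top hfin le_add_self)).1 (e1.symm.trans e2)

/-- The geometric series `(ε + S)⁻¹ = c ∑ (1 - c (ε + S))^k`, integrated termwise. -/
lemma lintegral_mul_inv_eq_tsum {μ : Measure T} [SFinite μ] [SFinite P]
    (hXm : AEMeasurable (fun y : T × A => X y.2 y.1) (μ.prod P))
    {g : EReal → ℝ≥0∞} (hg : Measurable g) {ε c : ℝ≥0∞} (hc : c ≠ ∞) (hc0 : c ≠ 0)
    (hle : ∀ a, c * (ε + ∫⁻ s, g (X a s) ∂μ) ≤ 1) {Φ : A → ℝ≥0∞} (hΦ : AEMeasurable Φ P) :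
    ∫⁻ a, Φ a * (ε + ∫⁻ s, g (X a s) ∂μ)⁻¹ ∂P =
      c * ∑' k : ℕ, ∫⁻ a, Φ a * (1 - (c * ε + ∫⁻ s, c * g (X a s) ∂μ)) ^ k ∂P := by
  have hS : AEMeasurable (fun a => ∫⁻ s, c * g (X a s) ∂μ) P :=
    AEMeasurable.lintegral_prod_left' (f := fun y : T × A => c * g (X y.2 y.1))
      ((hg.comp_aemeasurable hXm).const_mul c)
  have hm : ∀ k : ℕ, AEMeasurable
      (fun a => Φ a * (1 - (c * ε + ∫⁻ s, c * g (X a s) ∂μ)) ^ k) P := fun k =>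
    hΦ.mul ((aemeasurable_const.sub (aemeasurable_const.add hS)).pow_const k)
  rw [← lintegral_tsum hm, ← lintegral_const_mul' _ _ hc]
  refine lintegral_congr fun a => ?_
  rw [lintegral_const_mul' _ _ hc, ENNReal.tsum_mul_left, ENNReal.tsum_geometric, ← mul_add,
    ENNReal.sub_sub_cancel ENNReal.one_ne_top (hle _), ENNReal.mul_inv (Or.inl hc0) (Or.inl hc),
    mul_left_comm, ← mul_assoc c, ENNReal.mul_inv_cancel hc0 hc, one_mul]

lemma FddEq.lintegral_mul_inv_of_bounded {μ : Measure T} [IsFiniteMeasure μ] [IsFiniteMeasure P]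
    [IsFiniteMeasure Q] (h : FddEq X P Y Q)
    (hX : ∀ t, AEMeasurable (fun a => X a t) P) (hY : ∀ t, AEMeasurable (fun b => Y b t) Q)
    (hXm : AEMeasurable (fun y : T × A => X y.2 y.1) (μ.prod P))
    (hYm : AEMeasurable (fun y : T × B => Y y.2 y.1) (μ.prod Q))
    {g : EReal → ℝ≥0∞} (hg : Measurable g) {C ε : ℝ≥0∞} (hC : C ≠ ∞) (hgC : ∀ x, g x ≤ C)
    (hε : ε ≠ ∞) {n : ℕ} (t : Fin n → T) {Φ : (Fin n → EReal) → ℝ≥0∞} {K : ℝ≥0∞}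
    (hΦ : Measurable Φ) (hK : K ≠ ∞) (hΦK : ∀ y, Φ y ≤ K) :
    ∫⁻ a, Φ (fun i => X a (t i)) * (ε + ∫⁻ s, g (X a s) ∂μ)⁻¹ ∂P =
      ∫⁻ b, Φ (fun i => Y b (t i)) * (ε + ∫⁻ s, g (Y b s) ∂μ)⁻¹ ∂Q := by
  -- `M` bounds `ε + ∫ g(X(s)) μ(ds)` and is positive, so the geometric series can be used with
  -- `c = 1 / M`
  set M : ℝ≥0∞ := ε + C * μ Set.univ + 1 with hM
  have hM0 : M ≠ 0 := by simp [hM]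
  have hMt : M ≠ ∞ := by
    simp [hM, hε, ENNReal.mul_eq_top, hC, measure_ne_top]
  have hMi : M⁻¹ ≠ ∞ := ENNReal.inv_ne_top.2 hM0
  have hbound : M⁻¹ * ε + M⁻¹ * C * μ Set.univ ≤ 1 := by
    rw [mul_assoc, ← mul_add, ← ENNReal.inv_mul_cancel hM0 hMt]
    gcongr
    exact le_self_add
  have hpow := fun k => h.lintegral_mul_one_sub_pow hX hY hXm hYm (hg.const_mul M⁻¹)
    (ENNReal.mul_ne_top hMi hC) (fun x => by gcongr; exact hgC x) hbound k t hΦ hK hΦK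
  have hle : ∀ x : T → EReal, M⁻¹ * (ε + ∫⁻ s, g (x s) ∂μ) ≤ 1 := fun x => by
    refine le_trans ?_ hbound
    rw [mul_assoc, ← mul_add]
    gcongr
    exact (lintegral_mono fun s => hgC (x s)).trans_eq (lintegral_const C)
  rw [lintegral_mul_inv_eq_tsum (Φ := fun a => Φ fun i => X a (t i))
      hXm hg hMi (ENNReal.inv_ne_zero.2 hMt) (fun a => hle (X a))
      (hΦ.comp_aemeasurable (aemeasurable_pi_lambda _ fun i => hX (t i))),
    lintegral_mul_inv_eq_tsum (Φ := fun b => Φ fun i => Y b (t i))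
      hYm hg hMi (ENNReal.inv_ne_zero.2 hMt) (fun a => hle (Y a))
      (hΦ.comp_aemeasurable (aemeasurable_pi_lambda _ fun i => hY (t i)))]
  simp_rw [hpow]

lemma tendsto_lintegral_min_exp {μ : Measure T} [SigmaFinite μ] {x : T → EReal}
    (hx : AEMeasurable x μ) :
    Tendsto (fun n : ℕ => ∫⁻ s in spanningSets μ n, min (EReal.exp (x s)) n ∂μ) atTop
      (𝓝 (∫⁻ s, EReal.exp (x s) ∂μ)) := by
  simp_rw [← lintegral_indicator (measurableSet_spanningSets μ _)]
  refine lintegral_tendsto_of_tendsto_of_monotone (fun n => ?_) (ae_of_all _ fun s m n hmn => ?_)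
    (ae_of_all _ fun s => ?_)
  · exact ((EReal.measurable_exp.comp_aemeasurable hx).min aemeasurable_const).indicator
      (measurableSet_spanningSets μ n)
  · refine (Set.indicator_le_indicator_of_subset (monotone_spanningSets μ hmn)
      (fun _ => zero_le) s).trans (Set.indicator_le_indicator ?_)
    exact min_le_min le_rfl (by exact_mod_cast hmn)
  · have h1 : Tendsto (fun n : ℕ => min (EReal.exp (x s)) n) atTop
        (𝓝 (min (EReal.exp (x s)) ∞)) := tendsto_const_nhds.min ENNReal.tendsto_nat_nhds_top
    rw [min_top_right] at h1
    refine h1.congr' ?_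
    filter_upwards [eventually_ge_atTop (spanningSetsIndex μ s)] with n hn
    rw [Set.indicator_of_mem]
    exact monotone_spanningSets μ hn (mem_spanningSetsIndex μ s)

lemma tendsto_lintegral_mul_inv_truncated {μ : Measure T} [SigmaFinite μ] [IsFiniteMeasure P]
    (hXm : AEMeasurable (fun y : T × A => X y.2 y.1) (μ.prod P)) {ε : ℝ≥0∞} (hε : ε ≠ 0)
    {Φ : A → ℝ≥0∞} (hΦ : AEMeasurable Φ P) {K : ℝ≥0∞} (hK : K ≠ ∞) (hΦK : ∀ a, Φ a ≤ K) :
    Tendsto (fun n : ℕ => ∫⁻ a, Φ a *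
        (ε + ∫⁻ s in spanningSets μ n, min (EReal.exp (X a s)) n ∂μ)⁻¹ ∂P) atTop
      (𝓝 (∫⁻ a, Φ a * (ε + ∫⁻ s, EReal.exp (X a s) ∂μ)⁻¹ ∂P)) := by
  refine tendsto_lintegral_of_dominated_convergence' (fun _ => K * ε⁻¹) (fun n => ?_)
    (fun n => ae_of_all _ fun a => ?_) ?_ ?_
  · have hr : AEMeasurable (fun y : T × A => min (EReal.exp (X y.2 y.1)) n)
        ((μ.restrict (spanningSets μ n)).prod P) :=
      ((EReal.measurable_exp.comp_aemeasurable hXm).min aemeasurable_const).mono_ac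
        (Measure.restrict_le_self.absolutelyContinuous.prod Measure.AbsolutelyContinuous.rfl)
    exact hΦ.mul (aemeasurable_const.add hr.lintegral_prod_left').inv
  · exact mul_le_mul' (hΦK a) (ENNReal.inv_le_inv.2 le_self_add)
  · rw [lintegral_const]
    exact ENNReal.mul_ne_top (ENNReal.mul_ne_top hK (ENNReal.inv_ne_top.2 hε)) (measure_ne_top _ _)
  · filter_upwards [hXm.prod_swap.ae_prodMk_left] with a ha
    have h1 := (tendsto_lintegral_min_exp (x := X a) ha).const_add ε
    have h2 : Tendsto (fun y : ℝ≥0∞ => y⁻¹) (𝓝 (ε + ∫⁻ s, EReal.exp (X a s) ∂μ))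
      (𝓝 (ε + ∫⁻ s, EReal.exp (X a s) ∂μ)⁻¹) := continuous_inv.tendsto _
    refine ENNReal.Tendsto.const_mul (h2.comp h1) (Or.inr (ne_top_of_le_ne_top hK (hΦK a)))

lemma tendsto_lintegral_min_mul_inv {Φ S : A → ℝ≥0∞} (hΦ : AEMeasurable Φ P)
    (hS : AEMeasurable S P) :
    Tendsto (fun n : ℕ => ∫⁻ a, min (Φ a) n * ((n : ℝ≥0∞)⁻¹ + S a)⁻¹ ∂P) atTop
      (𝓝 (∫⁻ a, Φ a * (S a)⁻¹ ∂P)) := by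
  refine lintegral_tendsto_of_tendsto_of_monotone
    (fun n => (hΦ.min aemeasurable_const).mul (aemeasurable_const.add hS).inv)
    (ae_of_all _ fun a m n hmn => ?_) (ae_of_all _ fun a => ?_)
  · have : (m : ℝ≥0∞) ≤ n := by exact_mod_cast hmn
    dsimp only
    gcongr
  · have h1 : Tendsto (fun n : ℕ => min (Φ a) n) atTop (𝓝 (min (Φ a) ∞)) :=
      tendsto_const_nhds.min ENNReal.tendsto_nat_nhds_top
    have h2 : Tendsto (fun n : ℕ => (n : ℝ≥0∞)⁻¹ + S a) atTop (𝓝 (0 + S a)) :=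
      ENNReal.tendsto_inv_nat_nhds_zero.add_const _
    rw [min_top_right] at h1
    rw [zero_add] at h2
    have h3 : Tendsto (fun y : ℝ≥0∞ => y⁻¹) (𝓝 (S a)) (𝓝 (S a)⁻¹) := continuous_inv.tendsto _
    by_cases h0 : Φ a = 0
    · simp [h0]
    by_cases hSt : S a = ∞
    · simp [hSt]
    exact ENNReal.Tendsto.mul h1 (Or.inl h0) (h3.comp h2) (Or.inl (ENNReal.inv_ne_zero.2 hSt))

/-- `E[Φ(X(t)) / ∫ e^{X(s)} μ(ds)]` depends only on the finite-dimensional distributions of the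
jointly measurable process `X`. The bounded case is extended by truncating `exp` and `μ` while a
positive constant is added to the denominator, and then by truncating `Φ` while that constant
decreases to `0`. -/
lemma FddEq.lintegral_mul_inv_lintegral_exp {μ : Measure T} [SigmaFinite μ] [IsFiniteMeasure P]
    [IsFiniteMeasure Q] (h : FddEq X P Y Q)
    (hX : ∀ t, AEMeasurable (fun a => X a t) P) (hY : ∀ t, AEMeasurable (fun b => Y b t) Q)
    (hXm : AEMeasurable (fun y : T × A => X y.2 y.1) (μ.prod P))
    (hYm : AEMeasurable (fun y : T × B => Y y.2 y.1) (μ.prod Q))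
    {n : ℕ} (t : Fin n → T) {Φ : (Fin n → EReal) → ℝ≥0∞} (hΦ : Measurable Φ) :
    ∫⁻ a, Φ (fun i => X a (t i)) * (∫⁻ s, EReal.exp (X a s) ∂μ)⁻¹ ∂P =
      ∫⁻ b, Φ (fun i => Y b (t i)) * (∫⁻ s, EReal.exp (Y b s) ∂μ)⁻¹ ∂Q := by
  have hΦX : AEMeasurable (fun a => Φ fun i => X a (t i)) P :=
    hΦ.comp_aemeasurable (aemeasurable_pi_lambda _ fun i => hX (t i))
  have hΦY : AEMeasurable (fun b => Φ fun i => Y b (t i)) Q :=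
    hΦ.comp_aemeasurable (aemeasurable_pi_lambda _ fun i => hY (t i))
  refine tendsto_nhds_unique (tendsto_lintegral_min_mul_inv hΦX
    (EReal.measurable_exp.comp_aemeasurable hXm).lintegral_prod_left')
    ((tendsto_lintegral_min_mul_inv hΦY
    (EReal.measurable_exp.comp_aemeasurable hYm).lintegral_prod_left').congr' ?_)
  filter_upwards [eventually_gt_atTop 0] with m hm
  refine tendsto_nhds_unique (tendsto_lintegral_mul_inv_truncated hYm (ε := (m : ℝ≥0∞)⁻¹)
    (by simp) (hΦY.min aemeasurable_const) (ENNReal.natCast_ne_top m) fun _ => min_le_right _ _)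
    ((tendsto_lintegral_mul_inv_truncated hXm (ε := (m : ℝ≥0∞)⁻¹)
    (by simp) (hΦX.min aemeasurable_const) (ENNReal.natCast_ne_top m)
      fun _ => min_le_right _ _).congr fun k => ?_)
  have : IsFiniteMeasure (μ.restrict (spanningSets μ k)) :=
    ⟨by simpa using measure_spanningSets_lt_top μ k⟩
  exact h.lintegral_mul_inv_of_bounded hX hY
    (hXm.mono_ac (Measure.restrict_le_self.absolutelyContinuous.prod .rfl))
    (hYm.mono_ac (Measure.restrict_le_self.absolutelyContinuous.prod .rfl))
    (g := fun y => min (EReal.exp y) k)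
    (EReal.measurable_exp.min measurable_const) (ENNReal.natCast_ne_top k)
    (fun _ => min_le_right _ _) (by simpa using hm.ne') t (Φ := fun y => min (Φ y) m)
    (hΦ.min measurable_const) (ENNReal.natCast_ne_top m) (fun _ => min_le_right _ _)

end

/-! ### Tilted measures -/

lemma measurable_ereal_sub : Measurable fun y : EReal × EReal => y.1 - y.2 := by
  simp_rw [sub_eq_add_neg]
  exact measurable_fst.add (continuous_neg.measurable.comp measurable_snd)

lemma _root_.Measurable.ereal_sub {A : Type*} [MeasurableSpace A] {f g : A → EReal}
    (hf : Measurable f) (hg : Measurable g) : Measurable fun a => f a - g a :=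
  measurable_ereal_sub.comp (hf.prodMk hg)

lemma _root_.AEMeasurable.ereal_sub {A : Type*} [MeasurableSpace A] {P : Measure A}
    {f g : A → EReal} (hf : AEMeasurable f P) (hg : AEMeasurable g P) :
    AEMeasurable (fun a => f a - g a) P :=
  measurable_ereal_sub.comp_aemeasurable (hf.prodMk hg)

lemma exp_sub (x y : EReal) : EReal.exp (x - y) = EReal.exp x * (EReal.exp y)⁻¹ := by
  rw [sub_eq_add_neg, EReal.exp_add, EReal.exp_neg]

/-- This holds for all extended values, in particular for `S = 0` and `S = ∞`. -/
lemma exp_sub_log_sub (v c : EReal) (S : ℝ≥0∞) :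
    EReal.exp (v - ENNReal.log S - c) = EReal.exp (v - c) * S⁻¹ := by
  rw [exp_sub, exp_sub, exp_sub, ENNReal.exp_log, mul_right_comm]

lemma measurable_iSup_exp_sub {n : ℕ} (c : Fin n → EReal) :
    Measurable fun y : Fin n → EReal => ⨆ j, EReal.exp (y j - c j) :=
  Measurable.iSup fun j => EReal.measurable_exp.comp
    ((measurable_pi_apply j).ereal_sub measurable_const)

lemma FddEq.map_eq {T A B : Type*} [MeasurableSpace A] [MeasurableSpace B] {P : Measure A}
    {Q : Measure B} [IsFiniteMeasure P] {X : A → T → EReal} {Y : B → T → EReal}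
    (h : FddEq X P Y Q) (hX : Measurable X) (hY : Measurable Y) : P.map X = Q.map Y := by
  have hr : ∀ I : Finset T, (P.map X).map I.restrict = (Q.map Y).map I.restrict := fun I => by
    rw [Measure.map_map (Finset.measurable_restrict I) hX,
      Measure.map_map (Finset.measurable_restrict I) hY]
    let e := I.equivFin
    have hc : Measurable fun (y : Fin I.card → EReal) (i : I) => y (e i) :=
      measurable_pi_lambda _ fun i => measurable_pi_apply _
    have := congrArg (Measure.map fun (y : Fin I.card → EReal) (i : I) => y (e i))
      (h I.card fun k => (e.symm k : T))
    rw [Measure.map_map (f := fun a k => X a (e.symm k)) hc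
      (measurable_pi_lambda _ fun i => (measurable_pi_apply _).comp hX),
      Measure.map_map (f := fun b k => Y b (e.symm k)) hc
      (measurable_pi_lambda _ fun i => (measurable_pi_apply _).comp hY)] at this
    simpa [Function.comp_def, Finset.restrict_def] using this
  have h1 : IsProjectiveLimit (P.map X) fun I => (P.map X).map I.restrict := fun I => rfl
  have h2 : IsProjectiveLimit (Q.map Y) fun I => (P.map X).map I.restrict := fun I => (hr I).symm
  exact h1.unique h2

section Path

variable {T : Type*}

lemma PathSpace.measurable_eval (t : T) : Measurable fun f : PathSpace T => f t :=
  (measurable_pi_apply t).comp measurable_subtype_coe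

variable {Ω : Type*} [MeasurableSpace Ω] {P : Measure Ω} {Z : Ω → PathSpace T}

lemma measurable_eval_comp (hZ : Measurable Z) (t : T) : Measurable fun ω => Z ω t :=
  (PathSpace.measurable_eval t).comp hZ

lemma measurable_exp_eval (hZ : Measurable Z) (t : T) : Measurable fun ω => EReal.exp (Z ω t) :=
  EReal.measurable_exp.comp (measurable_eval_comp hZ t)

lemma measurable_tiltedProcess (hZ : Measurable Z) (a t : T) :
    Measurable fun ω => tiltedProcess Z a ω t :=
  (measurable_eval_comp hZ t).ereal_sub (measurable_eval_comp hZ a)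

lemma lintegral_tilt (hZ : Measurable Z) (a : T) (F : Ω → ℝ≥0∞) :
    ∫⁻ ω, F ω ∂(tilt P Z a) = ∫⁻ ω, EReal.exp (Z ω a) * F ω ∂P := by
  rw [tilt, lintegral_withDensity_eq_lintegral_mul_non_measurable _ (measurable_exp_eval hZ a)
    (ae_of_all _ fun ω => by simpa [lt_top_iff_ne_top] using (Z ω).2.1 a)]
  rfl

lemma isProbabilityMeasure_tilt {a : T} (h : ∫⁻ ω, EReal.exp (Z ω a) ∂P = 1) :
    IsProbabilityMeasure (tilt P Z a) :=
  ⟨by rw [tilt, withDensity_apply _ MeasurableSet.univ, Measure.restrict_univ, h]⟩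

lemma tilt_absolutelyContinuous (a : T) : tilt P Z a ≪ P := withDensity_absolutelyContinuous _ _

/-! ### The tilt-shift formula -/

lemma sub_sub_of_ne {x y : EReal} (hx : x ≠ ⊤) (hy : y ≠ ⊤) (c : ℝ) :
    (x + c) - (y + c) = x - y := by
  induction x with
  | top => exact absurd rfl hx
  | bot => simp
  | coe x =>
    induction y with
    | top => exact absurd rfl hy
    | bot => simp [← EReal.coe_add]
    | coe y => norm_cast; ring

variable [AddCommGroup T]

lemma fddEq_tiltedProcess_of_tilt_shift (hZ : Measurable Z)
    (H : ∀ Γ : PathSpace T → ℝ≥0, Measurable Γ →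
        (∀ (f : PathSpace T) (c : ℝ), Γ (f.addConst c) = Γ f) →
        ∀ a h : T, ∫⁻ ω, EReal.exp (Z ω (a + h)) * (Γ (Z ω) : ℝ≥0∞) ∂P =
          ∫⁻ ω, EReal.exp (Z ω a) * (Γ ((Z ω).lag h) : ℝ≥0∞) ∂P) (a h : T) :
    FddEq (tiltedProcess Z (a + h)) (tilt P Z (a + h))
        (fun ω t => tiltedProcess Z a ω (t - h)) (tilt P Z a) := by
  intro n t
  ext B hB
  -- the indicator of the event that the increments from the value at `a + h` lie in `B`
  let Γ : PathSpace T → ℝ≥0 := fun f => B.indicator (fun _ => 1) fun i => f (t i) - f (a + h)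
  have hm : Measurable fun (f : PathSpace T) (i : Fin n) => f (t i) - f (a + h) :=
    measurable_pi_lambda _ fun i =>
      (PathSpace.measurable_eval (t i)).ereal_sub (PathSpace.measurable_eval (a + h))
  have hΓ : Measurable Γ := (measurable_const.indicator hB).comp hm
  have key := H Γ hΓ (fun f c => by
    refine congrArg (B.indicator fun _ => (1 : ℝ≥0)) (funext fun i => ?_)
    exact sub_sub_of_ne (f.2.1 _) (f.2.1 _) c) a h
  rw [← lintegral_tilt hZ, ← lintegral_tilt hZ] at key
  have hind : ∀ y : Fin n → EReal, ((B.indicator (fun _ => (1 : ℝ≥0)) y : ℝ≥0) : ℝ≥0∞) =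
      B.indicator (fun _ => 1) y := fun y => by
    by_cases hy : y ∈ B <;> simp [hy]
  have hmap : ∀ (b : T) (φ : Ω → Fin n → EReal), Measurable φ →
      (tilt P Z b).map φ B = ∫⁻ ω, B.indicator (fun _ => 1) (φ ω) ∂(tilt P Z b) := fun b φ hφ => by
    rw [← lintegral_map (f := B.indicator fun _ => 1) (measurable_const.indicator hB) hφ,
      lintegral_indicator_const hB, one_mul]
  rw [hmap _ _ (measurable_pi_lambda _ fun i => measurable_tiltedProcess hZ _ _),
    hmap _ _ (measurable_pi_lambda _ fun i => measurable_tiltedProcess hZ _ _)]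
  simp only [Γ, hind] at key
  simpa [PathSpace.lag, tiltedProcess] using key

lemma sub_toReal {x y : EReal} (hy : y ≠ ⊤) (hy' : y ≠ ⊥) :
    x + ((-y.toReal : ℝ) : EReal) = x - y := by
  rw [EReal.coe_neg, EReal.coe_toReal hy hy', sub_eq_add_neg]

lemma tilt_shift_of_fddEq_tiltedProcess (hZ : Measurable Z)
    (hexp : ∀ t, ∫⁻ ω, EReal.exp (Z ω t) ∂P = 1) (hfin : ∀ h, ∀ᵐ ω ∂P, Z ω h ≠ ⊥) {a h : T}
    (H : FddEq (tiltedProcess Z (a + h)) (tilt P Z (a + h))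
        (fun ω t => tiltedProcess Z a ω (t - h)) (tilt P Z a))
    {Γ : PathSpace T → ℝ≥0} (hΓ : Measurable Γ)
    (hinv : ∀ (f : PathSpace T) (c : ℝ), Γ (f.addConst c) = Γ f) :
    ∫⁻ ω, EReal.exp (Z ω (a + h)) * (Γ (Z ω) : ℝ≥0∞) ∂P =
          ∫⁻ ω, EReal.exp (Z ω a) * (Γ ((Z ω).lag h) : ℝ≥0∞) ∂P := by
  -- the `σ`-field of `PathSpace T` is a trace, so `Γ` extends to a measurable function of all paths
  obtain ⟨Γ', hΓ', hfac⟩ := Measurable.exists_eq_measurable_comp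
    (f := (Subtype.val : PathSpace T → T → EReal)) hΓ
  have hprob := isProbabilityMeasure_tilt (hexp (a + h))
  have hmap := H.map_eq (measurable_pi_lambda _ fun t => measurable_tiltedProcess hZ _ _)
    (measurable_pi_lambda _ fun t => measurable_tiltedProcess hZ _ _)
  have hnorm : ∀ (f : PathSpace T) (s : T), f s ≠ ⊥ → Γ f = Γ' fun t => f t - f s := by
    intro f s hs
    rw [← hinv f (-(f s).toReal), hfac]
    exact congrArg Γ' (funext fun t => sub_toReal (f.2.1 s) hs)
  rw [← lintegral_tilt hZ, ← lintegral_tilt hZ]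
  have h1 : ∫⁻ ω, (Γ (Z ω) : ℝ≥0∞) ∂(tilt P Z (a + h)) =
      ∫⁻ ω, (Γ' (tiltedProcess Z (a + h) ω) : ℝ≥0∞) ∂(tilt P Z (a + h)) := by
    refine lintegral_congr_ae ?_
    filter_upwards [(tilt_absolutelyContinuous (a + h)).ae_le (hfin (a + h))] with ω hω
    rw [hnorm _ _ hω]
    rfl
  have h2 : ∫⁻ ω, (Γ ((Z ω).lag h) : ℝ≥0∞) ∂(tilt P Z a) =
      ∫⁻ ω, (Γ' (fun t => tiltedProcess Z a ω (t - h)) : ℝ≥0∞) ∂(tilt P Z a) := by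
    refine lintegral_congr_ae ?_
    filter_upwards [(tilt_absolutelyContinuous a).ae_le (hfin a)] with ω hω
    rw [hnorm _ (a + h) (by simpa [PathSpace.lag] using hω)]
    simp [PathSpace.lag, tiltedProcess]
  have hm := measurable_coe_nnreal_ennreal.comp hΓ'
  rw [h1, h2, ← lintegral_map (f := fun y => (Γ' y : ℝ≥0∞)) hm
    (measurable_pi_lambda _ fun t => measurable_tiltedProcess hZ _ _), hmap,
    lintegral_map (f := fun y => (Γ' y : ℝ≥0∞)) hm
    (measurable_pi_lambda _ fun t => measurable_tiltedProcess hZ _ _)]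

end Path

/-! ### From the exponent function to the tilted laws -/

section Deriv

variable {A : Type*} [MeasurableSpace A] {P : Measure A}

/-- The right derivative at `r = 1` of `r ↦ E[max (r X, M)]` is `E[X; M ≤ X]`. -/
lemma tendsto_lintegral_max_sub {X M : A → ℝ≥0∞} (hX : Measurable X) (hM : Measurable M)
    (hXf : ∫⁻ a, X a ∂P ≠ ∞) (hMf : ∫⁻ a, M a ∂P ≠ ∞) :
    Tendsto (fun k : ℕ => (k : ℝ≥0∞) *
        (∫⁻ a, max ((1 + (k : ℝ≥0∞)⁻¹) * X a) (M a) ∂P - ∫⁻ a, max (X a) (M a) ∂P)) atTop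
      (𝓝 (∫⁻ a, {a | M a ≤ X a}.indicator X a ∂P)) := by
  have hsum : ∫⁻ a, max (X a) (M a) ∂P ≠ ∞ := by
    refine ne_top_of_le_ne_top (ENNReal.add_ne_top.2 ⟨hXf, hMf⟩) ?_
    rw [← lintegral_add_left hX]
    exact lintegral_mono fun a => max_le le_self_add le_add_self
  have hle : ∀ (k : ℕ) a, max (X a) (M a) ≤ max ((1 + (k : ℝ≥0∞)⁻¹) * X a) (M a) := fun k a =>
    max_le_max (le_mul_of_one_le_left (zero_le) le_self_add) le_rfl
  have hcongr : ∀ k : ℕ, (k : ℝ≥0∞) *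
        (∫⁻ a, max ((1 + (k : ℝ≥0∞)⁻¹) * X a) (M a) ∂P - ∫⁻ a, max (X a) (M a) ∂P) =
      ∫⁻ a, (k : ℝ≥0∞) * (max ((1 + (k : ℝ≥0∞)⁻¹) * X a) (M a) - max (X a) (M a)) ∂P := by
    intro k
    rw [lintegral_const_mul' _ _ (ENNReal.natCast_ne_top k),
      lintegral_sub (hX.max hM) hsum (ae_of_all _ (hle k))]
  simp_rw [hcongr]
  refine tendsto_lintegral_of_dominated_convergence' X (fun k => ?_)
    (fun k => ae_of_all _ fun a => ?_) hXf ?_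
  · exact ((((hX.const_mul _).max hM).sub (hX.max hM)).const_mul _).aemeasurable
  · by_cases hk : k = 0
    · simp [hk]
    have hk0 : (k : ℝ≥0∞) ≠ 0 := by exact_mod_cast hk
    calc (k : ℝ≥0∞) * (max ((1 + (k : ℝ≥0∞)⁻¹) * X a) (M a) - max (X a) (M a))
        ≤ (k : ℝ≥0∞) * ((k : ℝ≥0∞)⁻¹ * X a) := by
          gcongr
          rw [tsub_le_iff_right, add_mul, one_mul]
          refine max_le ?_ ?_
          · rw [add_comm]; gcongr; exact le_max_left _ _
          · exact le_add_left (le_max_right _ _)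
      _ = X a := by
          rw [← mul_assoc, ENNReal.mul_inv_cancel hk0 (ENNReal.natCast_ne_top k), one_mul]
  · filter_upwards [ae_lt_top hX hXf] with a ha
    by_cases hMX : M a ≤ X a
    · rw [Set.indicator_of_mem (show a ∈ {a | M a ≤ X a} from hMX)]
      refine tendsto_const_nhds.congr' ?_
      filter_upwards [eventually_gt_atTop 0] with k hk
      have hk0 : (k : ℝ≥0∞) ≠ 0 := by exact_mod_cast hk.ne'
      rw [max_eq_left hMX, max_eq_left (hMX.trans
        (le_mul_of_one_le_left (zero_le) le_self_add)), add_mul, one_mul,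
        ENNReal.add_sub_cancel_left ha.ne, ← mul_assoc,
        ENNReal.mul_inv_cancel hk0 (ENNReal.natCast_ne_top k), one_mul]
    · rw [Set.indicator_of_notMem (show a ∉ {a | M a ≤ X a} from hMX)]
      have h1 : Tendsto (fun k : ℕ => (1 + (k : ℝ≥0∞)⁻¹) * X a) atTop (𝓝 ((1 + 0) * X a)) :=
        ENNReal.Tendsto.mul_const (ENNReal.tendsto_inv_nat_nhds_zero.const_add 1) (Or.inr ha.ne)
      rw [add_zero, one_mul] at h1
      refine tendsto_const_nhds.congr' ?_
      filter_upwards [h1.eventually_lt_const (not_le.1 hMX)] with k hk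
      rw [max_eq_right hk.le, max_eq_right (not_le.1 hMX).le, tsub_self, mul_zero]

end Deriv

section Exponent

variable {T : Type*} {Ω : Type*} [MeasurableSpace Ω] {P : Measure Ω}
  {Z : Ω → PathSpace T}

lemma lintegral_iSup_exp_sub_ne_top (hZ : Measurable Z)
    (hexp : ∀ t, ∫⁻ ω, EReal.exp (Z ω t) ∂P = 1) {n : ℕ} (t : Fin n → T) {c : Fin n → EReal}
    (hc : ∀ j, c j ≠ ⊥) : ∫⁻ ω, ⨆ j, EReal.exp (Z ω (t j) - c j) ∂P ≠ ∞ := by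
  refine ne_top_of_le_ne_top (b := ∑ j, (EReal.exp (c j))⁻¹) ?_ ?_
  · exact ENNReal.sum_ne_top.2 fun j _ => ENNReal.inv_ne_top.2 (by simpa using hc j)
  · calc ∫⁻ ω, ⨆ j, EReal.exp (Z ω (t j) - c j) ∂P
        ≤ ∫⁻ ω, ∑ j, EReal.exp (Z ω (t j)) * (EReal.exp (c j))⁻¹ ∂P :=
          lintegral_mono fun ω => iSup_le fun j => by
            rw [exp_sub]
            exact Finset.single_le_sum (f := fun j => EReal.exp (Z ω (t j)) * (EReal.exp (c j))⁻¹)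
              (fun _ _ => zero_le) (Finset.mem_univ j)
      _ = _ := by
          rw [lintegral_finsetSum _ fun j _ => (measurable_exp_eval hZ _).mul_const _]
          refine Finset.sum_congr rfl fun j _ => ?_
          rw [lintegral_mul_const _ (measurable_exp_eval hZ _), hexp, one_mul]

lemma iSup_exp_sub_le_iff {n : ℕ} {z c : Fin n → EReal} {x : EReal} 
    (hc : ∀ j, c j ≠ ⊥) (hx : x ≠ ⊤) (hx' : x ≠ ⊥) :
    ⨆ j, EReal.exp (z j - c j) ≤ EReal.exp x ↔ ∀ j, z j - x ≤ c j := by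
  rw [iSup_le_iff]
  refine forall_congr' fun j => ?_
  rw [EReal.exp_le_exp_iff, EReal.sub_le_iff_le_add (Or.inl (hc j)) (Or.inr hx'),
    EReal.sub_le_iff_le_add (Or.inl hx') (Or.inl hx), add_comm]

lemma tilt_setOf_tiltedProcess_le (hZ : Measurable Z) (hfin : ∀ h, ∀ᵐ ω ∂P, Z ω h ≠ ⊥) {n : ℕ}
    (t : Fin n → T) (a : T) {c : Fin n → EReal} (hc : ∀ j, c j ≠ ⊥) :
    tilt P Z a {ω | ∀ j, tiltedProcess Z a ω (t j) ≤ c j} =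
      ∫⁻ ω, {ω | ⨆ j, EReal.exp (Z ω (t j) - c j) ≤ EReal.exp (Z ω a)}.indicator
        (fun ω => EReal.exp (Z ω a)) ω ∂P := by
  have hm : MeasurableSet {ω | ∀ j, tiltedProcess Z a ω (t j) ≤ c j} := by
    rw [Set.ofPred_forall]
    exact MeasurableSet.iInter fun j =>
      measurableSet_le (measurable_tiltedProcess hZ _ _) measurable_const
  rw [← lintegral_indicator_one hm, lintegral_tilt hZ]
  refine lintegral_congr_ae ?_
  filter_upwards [hfin a] with ω hω
  have hiff := iSup_exp_sub_le_iff (z := fun j => Z ω (t j)) (c := c) (x := Z ω a)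
    hc ((Z ω).2.1 a) hω
  by_cases h : ∀ j, Z ω (t j) - Z ω a ≤ c j
  · rw [Set.indicator_of_mem (by exact h), Set.indicator_of_mem (by exact hiff.2 h)]
    simp
  · rw [Set.indicator_of_notMem (by exact h),
      Set.indicator_of_notMem (by exact fun h' => h (hiff.1 h'))]
    simp

/-- A multiple `r e^{f(a)}` is the term of the maximum for the additional time `a` and the
additional bound `-ln r`. -/
lemma max_mul_exp_eq_iSup {n : ℕ} (f : T → EReal) (t : Fin n → T) (c : Fin n → EReal) (a : T)
    (r : ℝ≥0∞) :
    max (r * EReal.exp (f a)) (⨆ j, EReal.exp (f (t j) - c j)) =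
      ⨆ j, EReal.exp (f ((Fin.cons a t : Fin (n + 1) → T) j) -
        (Fin.cons (-ENNReal.log r) c : Fin (n + 1) → EReal) j) := by
  refine le_antisymm (max_le ?_ (iSup_le fun j => ?_)) (iSup_le fun j => ?_)
  · refine le_iSup_of_le 0 ?_
    simp [exp_sub, EReal.exp_neg, mul_comm]
  · refine le_iSup_of_le j.succ ?_
    simp
  · induction j using Fin.cases with
    | zero => 
      refine le_max_of_le_left ?_
      simp [exp_sub, EReal.exp_neg, mul_comm]
    | succ j =>
      refine le_max_of_le_right (le_iSup_of_le j ?_)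
      simp

variable [AddCommGroup T]

/-- If the exponent function is invariant under the shift by `h`, then tilting at `a + h` is tilting
at `a` followed by the shift. -/
lemma fddEq_tiltedProcess_of_exponent (hZ : Measurable Z)
    (hexp : ∀ t, ∫⁻ ω, EReal.exp (Z ω t) ∂P = 1) (hfin : ∀ h, ∀ᵐ ω ∂P, Z ω h ≠ ⊥) {h : T}
    (H : ∀ (n : ℕ) (t : Fin n → T) (c : Fin n → EReal),
      ∫⁻ ω, ⨆ j, EReal.exp (Z ω (t j) - c j) ∂P =
        ∫⁻ ω, ⨆ j, EReal.exp (Z ω (t j - h) - c j) ∂P) (a : T) :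
    FddEq (tiltedProcess Z (a + h)) (tilt P Z (a + h))
        (fun ω t => tiltedProcess Z a ω (t - h)) (tilt P Z a) := by
  intro n t
  have hprob := isProbabilityMeasure_tilt (hexp (a + h))
  refine ext_of_forall_le fun c hc => ?_
  rw [Measure.map_apply (measurable_pi_lambda _ fun i => measurable_tiltedProcess hZ _ _)
    (measurableSet_setOf_forall_le c),
    Measure.map_apply (measurable_pi_lambda _ fun i => measurable_tiltedProcess hZ _ _)
    (measurableSet_setOf_forall_le c)]
  refine (tilt_setOf_tiltedProcess_le hZ hfin t (a + h) hc).trans (Eq.trans ?_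
    (tilt_setOf_tiltedProcess_le hZ hfin (fun j => t j - h) a hc).symm)
  have hM : ∀ t : Fin n → T, Measurable fun ω => ⨆ j, EReal.exp (Z ω (t j) - c j) := fun t =>
    (measurable_iSup_exp_sub c).comp (measurable_pi_lambda _ fun j => measurable_eval_comp hZ (t j))
  have hone : ∀ b, ∫⁻ ω, EReal.exp (Z ω b) ∂P ≠ ∞ := fun b => by simp [hexp]
  refine tendsto_nhds_unique
    (tendsto_lintegral_max_sub (measurable_exp_eval hZ (a + h)) (hM t) (hone _)
      (lintegral_iSup_exp_sub_ne_top hZ hexp t hc))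
    ((tendsto_lintegral_max_sub (measurable_exp_eval hZ a) (hM fun j => t j - h) (hone _)
      (lintegral_iSup_exp_sub_ne_top hZ hexp _ hc)).congr' ?_)
  have hmax : ∀ r : ℝ≥0∞,
      ∫⁻ ω, max (r * EReal.exp (Z ω a)) (⨆ j, EReal.exp (Z ω (t j - h) - c j)) ∂P =
        ∫⁻ ω, max (r * EReal.exp (Z ω (a + h))) (⨆ j, EReal.exp (Z ω (t j) - c j)) ∂P := by
    intro r
    have e1 : ∀ ω, max (r * EReal.exp (Z ω a)) (⨆ j, EReal.exp (Z ω (t j - h) - c j)) =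
        ⨆ j, EReal.exp (Z ω ((Fin.cons (a + h) t : Fin (n + 1) → T) j - h) -
        (Fin.cons (-ENNReal.log r) c : Fin (n + 1) → EReal) j) := fun ω => by
      rw [max_mul_exp_eq_iSup (Z ω) (fun j => t j - h) c a r]
      refine iSup_congr fun j => ?_
      induction j using Fin.cases with
      | zero => simp
      | succ j => simp
    simp_rw [e1]
    rw [← H]
    exact lintegral_congr fun ω => (max_mul_exp_eq_iSup (Z ω) t c (a + h) r).symm
  refine Eventually.of_forall fun k => ?_
  have h1 := hmax 1
  simp only [one_mul] at h1
  beta_reduce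
  rw [h1, hmax]

end Exponent

/-! ### Exponent functions of the two max-processes -/

section

variable {T : Type*} {Ω : Type*} [MeasurableSpace Ω] {P : Measure Ω} {Z : Ω → PathSpace T}

lemma IsMarkedPoisson.aemeasurable_maxProcess_and_measure_le [IsProbabilityMeasure P]
    (hZ : Measurable Z) {Ω₁ : Type*}
    [MeasurableSpace Ω₁] {P₁ : Measure Ω₁} [IsProbabilityMeasure P₁] {p : ℕ → Ω₁ → ℝ}
    {z : ℕ → Ω₁ → PathSpace T} (hpz : IsMarkedPoisson expIntensity (P.map Z) p z P₁) {n : ℕ}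
    (t : Fin n → T) :
    AEMeasurable (fun ω j => maxProcess p (fun i ω => z i ω) ω (t j)) P₁ ∧
    ∀ c : Fin n → EReal, P₁ {ω | ∀ j, maxProcess p (fun i ω => z i ω) ω (t j) ≤ c j} =
      expNeg (∫⁻ ω, ⨆ j, EReal.exp (Z ω (t j) - c j) ∂P) := by
  have hprob : IsProbabilityMeasure (P.map Z) := Measure.isProbabilityMeasure_map hZ.aemeasurable
  have hm : IsMarkedPoisson (expIntensity.prod (Measure.dirac ())) (P.map Z)
      (fun i ω => (p i ω, ())) z P₁ :=
    { poisson := hpz.poisson.prodMk_dirac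
        (measurable_pi_lambda _ hpz.poisson.measurable_point) rfl ()
      measurable_mark := hpz.measurable_mark
      map_mark := hpz.map_mark
      indep_mark := hpz.indep_mark
      indep := hpz.indep.comp (φ := fun (s : ℕ → ℝ) i => (s i, ()))
        (ψ := fun y : ℕ → PathSpace T => y) (by fun_prop) measurable_id }
  have hw : ∀ j, Measurable fun y : Unit × PathSpace T => y.2 (t j) := fun j =>
    (PathSpace.measurable_eval (t j)).comp measurable_snd
  obtain ⟨h1, h2⟩ := hm.aemeasurable_max_and_measure_max_le
    (w := fun j y => y.2 (t j)) fun j => (hw j).aemeasurable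
  refine ⟨h1, fun c => (h2 c).trans ?_⟩
  rw [Measure.dirac_prod, lintegral_map (f := fun y : Unit × PathSpace T =>
    ⨆ j, EReal.exp (y.2 (t j) - c j))
    ((measurable_iSup_exp_sub c).comp (measurable_pi_lambda _ hw)) measurable_prodMk_left,
    lintegral_map (f := fun y : PathSpace T => ⨆ j, EReal.exp (y (t j) - c j))
    ((measurable_iSup_exp_sub c).comp (measurable_pi_lambda _ fun j =>
      PathSpace.measurable_eval (t j))) hZ]

end

/-- The map of a measure under a function that is not almost everywhere measurable is `0`, so a
process with the finite-dimensional distributions of a measurable one has almost everywhere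
measurable coordinates. -/
lemma FddEq.aemeasurable {T A B : Type*} [MeasurableSpace A] [MeasurableSpace B] {P : Measure A}
    {Q : Measure B} [IsProbabilityMeasure Q] {X : A → T → EReal} {Y : B → T → EReal}
    (h : FddEq X P Y Q) (hY : ∀ t, Measurable fun b => Y b t) (t : T) :
    AEMeasurable (fun a => X a t) P := by
  have h1 : AEMeasurable (fun a (_ : Fin 1) => X a t) P := by
    by_contra hc
    have := h 1 fun _ => t
    rw [Measure.map_of_not_aemeasurable hc] at this
    have hp : IsProbabilityMeasure (Q.map fun b (_ : Fin 1) => Y b t) :=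
      Measure.isProbabilityMeasure_map (measurable_pi_lambda _ fun _ => hY t).aemeasurable
    exact IsProbabilityMeasure.ne_zero _ this.symm
  exact (measurable_pi_apply (0 : Fin 1)).comp_aemeasurable h1

section Tilt

variable {T Ω : Type*} [MeasurableSpace T] [MeasurableSpace Ω] {P : Measure Ω} {μ : Measure T}
  {Z : Ω → PathSpace T}

lemma aemeasurable_tiltedProcess [IsProbabilityMeasure P] (hZ : Measurable Z)
    (hZm : AEMeasurable (fun y : T × Ω => Z y.2 y.1) (μ.prod P)) (b : T)
    [SFinite (tilt P Z b)] :
    AEMeasurable (fun y : T × Ω => tiltedProcess Z b y.2 y.1) (μ.prod (tilt P Z b)) :=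
  (hZm.mono_ac (Measure.AbsolutelyContinuous.rfl.prod (tilt_absolutelyContinuous b))).ereal_sub
    ((measurable_eval_comp hZ b).comp measurable_snd).aemeasurable

lemma lintegral_tilt_iSup_mul_inv (hZ : Measurable Z) (hfin : ∀ h, ∀ᵐ ω ∂P, Z ω h ≠ ⊥) (b : T)
    {n : ℕ} (t : Fin n → T) (c : Fin n → EReal) :
    ∫⁻ ω, (⨆ j, EReal.exp (tiltedProcess Z b ω (t j) - c j)) *
        (∫⁻ s, EReal.exp (tiltedProcess Z b ω s) ∂μ)⁻¹ ∂(tilt P Z b) =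
      ∫⁻ ω, EReal.exp (Z ω b) * ((⨆ j, EReal.exp (Z ω (t j) - c j)) *
        (∫⁻ s, EReal.exp (Z ω s) ∂μ)⁻¹) ∂P := by
  rw [lintegral_tilt hZ]
  refine lintegral_congr_ae ?_
  filter_upwards [hfin b] with ω hω
  have h0 : EReal.exp (Z ω b) ≠ 0 := by simpa using hω
  have ht : EReal.exp (Z ω b) ≠ ∞ := by simpa using (Z ω).2.1 b
  have hi : (EReal.exp (Z ω b))⁻¹ ≠ ∞ := ENNReal.inv_ne_top.2 h0
  have hi0 : (EReal.exp (Z ω b))⁻¹ ≠ 0 := ENNReal.inv_ne_zero.2 ht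
  have h1 : ∀ j, EReal.exp (tiltedProcess Z b ω (t j) - c j) =
      EReal.exp (Z ω (t j) - c j) * (EReal.exp (Z ω b))⁻¹ := fun j => by
    rw [tiltedProcess, exp_sub, exp_sub, exp_sub, mul_right_comm]
  simp_rw [h1, tiltedProcess, exp_sub (Z ω _) (Z ω b)]
  rw [← ENNReal.iSup_mul, lintegral_mul_const' _ _ hi, ENNReal.mul_inv (Or.inr hi) (Or.inr hi0),
    inv_inv]
  congr 1
  calc _ = (⨆ j, EReal.exp (Z ω (t j) - c j)) * (∫⁻ s, EReal.exp (Z ω s) ∂μ)⁻¹ *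
        ((EReal.exp (Z ω b))⁻¹ * EReal.exp (Z ω b)) := by ring
    _ = _ := by rw [ENNReal.inv_mul_cancel h0 ht, mul_one]

variable [SigmaFinite μ]

/-- By Tonelli's theorem, the integral of `e^{Z(b)}` over `b` cancels the denominator. -/
lemma lintegral_lintegral_iSup_mul_inv [IsProbabilityMeasure P] (hZ : Measurable Z)
    (hZm : AEMeasurable (fun y : T × Ω => Z y.2 y.1) (μ.prod P))
    (hS : ∀ᵐ ω ∂P, 0 < ∫⁻ s, EReal.exp (Z ω s) ∂μ ∧ ∫⁻ s, EReal.exp (Z ω s) ∂μ < ∞)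
    {n : ℕ} (t : Fin n → T) (c : Fin n → EReal) :
    ∫⁻ b, ∫⁻ ω, EReal.exp (Z ω b) * ((⨆ j, EReal.exp (Z ω (t j) - c j)) *
        (∫⁻ s, EReal.exp (Z ω s) ∂μ)⁻¹) ∂P ∂μ =
      ∫⁻ ω, ⨆ j, EReal.exp (Z ω (t j) - c j) ∂P := by
  have hZe : AEMeasurable (fun y : T × Ω => EReal.exp (Z y.2 y.1)) (μ.prod P) :=
    EReal.measurable_exp.comp_aemeasurable hZm
  have hSm : AEMeasurable (fun ω => ∫⁻ s, EReal.exp (Z ω s) ∂μ) P := hZe.lintegral_prod_left'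
  have hM : Measurable fun ω => ⨆ j, EReal.exp (Z ω (t j) - c j) :=
    (measurable_iSup_exp_sub c).comp (measurable_pi_lambda _ fun j => measurable_eval_comp hZ (t j))
  rw [lintegral_lintegral_swap (hZe.mul (hM.aemeasurable.mul hSm.inv).comp_snd)]
  refine lintegral_congr_ae ?_
  filter_upwards [hS, hZe.prod_swap.ae_prodMk_left] with ω hω hm
  have hm' : AEMeasurable (fun b => EReal.exp (Z ω b)) μ := hm
  rw [lintegral_mul_const'' _ hm', mul_left_comm, ENNReal.mul_inv_cancel hω.1.ne' hω.2.ne, mul_one]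

end Tilt

section Shift

variable {T : Type*} [AddCommGroup T] [MeasurableSpace T] {μ : Measure T} [SigmaFinite μ]
  {E : Type*} [MeasurableSpace E] {Q : Measure E} [IsProbabilityMeasure Q] {V : E → T → EReal}

lemma IsShiftMeasurable.aemeasurable_integral (h : IsShiftMeasurable V μ Q) :
    AEMeasurable (fun y : T × E => ∫⁻ s, EReal.exp (V y.2 (s - y.1)) ∂μ) (μ.prod Q) :=
  AEMeasurable.lintegral_prod_left' (f := fun q : T × (T × E) => EReal.exp (V q.2.2 (q.1 - q.2.1)))
    (EReal.measurable_exp.comp_aemeasurable h.integrand)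

lemma IsShiftMeasurable.ae_aemeasurable (h : IsShiftMeasurable V μ Q) :
    ∀ᵐ b ∂μ, AEMeasurable (fun y : T × E => V y.2 (y.1 - b)) (μ.prod Q) := by
  have h1 := h.integrand.prod_swap.comp_quasiMeasurePreserving
    (measurePreserving_prodAssoc μ Q μ).symm.quasiMeasurePreserving
  filter_upwards [h1.ae_prodMk_left] with b hb
  exact hb.prod_swap

variable {Ω : Type*} [MeasurableSpace Ω] {P : Measure Ω}

lemma IsMarkedPoisson.aemeasurable_shifted_and_measure_le [IsProbabilityMeasure P]
    (hV : IsShiftMeasurable V μ Q) {q : ℕ → Ω → ℝ × T} {x : ℕ → Ω → E}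
    (hm : IsMarkedPoisson (expIntensity.prod μ) Q q x P) {n : ℕ} (t : Fin n → T) :
    AEMeasurable (fun ω j => maxProcess (fun i ω => (q i ω).1)
      (fun i => logNormalize μ fun ω t => V (x i ω) (t - (q i ω).2)) ω (t j)) P ∧
    ∀ c : Fin n → EReal, P {ω | ∀ j, maxProcess (fun i ω => (q i ω).1)
      (fun i => logNormalize μ fun ω t => V (x i ω) (t - (q i ω).2)) ω (t j) ≤ c j} =
      expNeg (∫⁻ b, ∫⁻ e, (⨆ j, EReal.exp (V e (t j - b) - c j)) *
        (∫⁻ s, EReal.exp (V e (s - b)) ∂μ)⁻¹ ∂Q ∂μ) := by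
  have hS := hV.aemeasurable_integral
  obtain ⟨h1, h2⟩ := hm.aemeasurable_max_and_measure_max_le (w := fun j y =>
      V y.2 (t j - y.1) - ENNReal.log (∫⁻ s, EReal.exp (V y.2 (s - y.1)) ∂μ)) fun j =>
    (hV.eval (t j)).ereal_sub (ENNReal.measurable_log.comp_aemeasurable hS)
  refine ⟨h1, fun c => (h2 c).trans ?_⟩
  simp_rw [exp_sub_log_sub, ← ENNReal.iSup_mul]
  rw [lintegral_prod]
  exact ((measurable_iSup_exp_sub c).comp_aemeasurable
    (aemeasurable_pi_lambda _ fun j => hV.eval (t j))).mul hS.inv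

variable {Z : Ω → PathSpace T}

/-- The exponent function of the randomly shifted copies of `V` is that of `Z`. -/
lemma lintegral_shift_eq_of_fddEq_tiltedProcess [IsProbabilityMeasure P] (hZ : Measurable Z)
    (hexp : ∀ t, ∫⁻ ω, EReal.exp (Z ω t) ∂P = 1) (hfin : ∀ h, ∀ᵐ ω ∂P, Z ω h ≠ ⊥)
    (H : ∀ h, FddEq (tiltedProcess Z h) (tilt P Z h)
        (fun ω t => tiltedProcess Z 0 ω (t - h)) (tilt P Z 0))
    (hZm : AEMeasurable (fun y : T × Ω => Z y.2 y.1) (μ.prod P))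
    (hS : ∀ᵐ ω ∂P, 0 < ∫⁻ s, EReal.exp (Z ω s) ∂μ ∧ ∫⁻ s, EReal.exp (Z ω s) ∂μ < ∞)
    (hVZ : FddEq V Q (tiltedProcess Z 0) (tilt P Z 0)) (hV : IsShiftMeasurable V μ Q)
    {n : ℕ} (t : Fin n → T) (c : Fin n → EReal) :
    ∫⁻ b, ∫⁻ e, (⨆ j, EReal.exp (V e (t j - b) - c j)) *
        (∫⁻ s, EReal.exp (V e (s - b)) ∂μ)⁻¹ ∂Q ∂μ =
      ∫⁻ ω, ⨆ j, EReal.exp (Z ω (t j) - c j) ∂P := by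
  have hprob : ∀ b, IsProbabilityMeasure (tilt P Z b) := fun b =>
    isProbabilityMeasure_tilt (hexp b)
  rw [← lintegral_lintegral_iSup_mul_inv hZ hZm hS t c]
  refine lintegral_congr_ae ?_
  filter_upwards [hV.ae_aemeasurable] with b hb
  have hfdd : FddEq (fun e s => V e (s - b)) Q (tiltedProcess Z b) (tilt P Z b) := fun m s =>
    (hVZ m fun i => s i - b).trans (H b m s).symm
  rw [← lintegral_tilt_iSup_mul_inv hZ hfin b t c]
  exact hfdd.lintegral_mul_inv_lintegral_exp
    (hfdd.aemeasurable fun t => measurable_tiltedProcess hZ b t)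
    (fun t => (measurable_tiltedProcess hZ b t).aemeasurable) hb
    (aemeasurable_tiltedProcess hZ hZm b) t (measurable_iSup_exp_sub c)

end Shift

/-! ### The representation for a unit mass -/

section Dirac

variable {T : Type*} [MeasurableSpace T]

/-- The law of the points of a Poisson process, with independent marks added on a product space. The
universe of this space does not depend on that of the space of the given process. -/
lemma IsPoissonProcess.isMarkedPoisson_prod_infinitePi {S Ω E : Type*} [MeasurableSpace S]
    [MeasurableSpace Ω] [MeasurableSpace E] {ν : Measure S} [SFinite ν] {p : ℕ → Ω → S}
    {P : Measure Ω} [IsProbabilityMeasure P] (hp : IsPoissonProcess ν p P) (Q : Measure E)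
    [IsProbabilityMeasure Q] (b : T) :
    IsMarkedPoisson (ν.prod (Measure.dirac b)) Q
      (fun i (y : (ℕ → S) × (ℕ → E)) => (y.1 i, b)) (fun i y => y.2 i)
      ((P.map fun ω i => p i ω).prod (Measure.infinitePi fun _ => Q)) := by
  have hpm : Measurable fun ω i => p i ω := measurable_pi_lambda _ hp.measurable_point
  have : IsProbabilityMeasure (P.map fun ω i => p i ω) :=
    Measure.isProbabilityMeasure_map hpm.aemeasurable
  have hmark : ∀ i, ((P.map fun ω i => p i ω).prod (Measure.infinitePi fun _ : ℕ => Q)).map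
      (fun y : (ℕ → S) × (ℕ → E) => y.2 i) = Q := fun i => by
    rw [← Function.comp_def (fun z : ℕ → E => z i) Prod.snd,
      ← Measure.map_map (measurable_pi_apply i) measurable_snd, Measure.map_snd_prod, measure_univ,
      one_smul]
    exact Measure.infinitePi_map_eval _ i
  exact
    { poisson := hp.prodMk_dirac measurable_fst (by
        rw [Measure.map_fst_prod, measure_univ, one_smul]) b
      measurable_mark := fun i => (measurable_pi_apply i).comp measurable_snd
      map_mark := hmark
      indep_mark := by
        refine (iIndepFun_iff_map_fun_eq_infinitePi_map
          (X := fun i (y : (ℕ → S) × (ℕ → E)) => y.2 i) fun i =>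
          (measurable_pi_apply i).comp measurable_snd).2 ?_
        simp_rw [hmark]
        change Measure.map Prod.snd _ = _
        rw [Measure.map_snd_prod, measure_univ, one_smul]
      indep := indepFun_prod (X := fun (s : ℕ → S) i => (s i, b)) (Y := fun z : ℕ → E => z)
        (by fun_prop) measurable_id }

variable [MeasurableSingletonClass T]

lemma aemeasurable_dirac_prod {E γ : Type*} [MeasurableSpace E] [MeasurableSpace γ] {Q : Measure E}
    [SFinite Q] {f : T × E → γ} (b : T) (hf : Measurable fun e => f (b, e)) :
    AEMeasurable f ((Measure.dirac b).prod Q) := by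
  refine ⟨fun y => f (b, y.2), hf.comp measurable_snd, ?_⟩
  have h : ∀ᵐ y ∂((Measure.dirac b).prod Q), y.1 = b :=
    Measure.quasiMeasurePreserving_fst.ae (p := fun s => s = b) (by simp)
  filter_upwards [h] with y hy
  rw [← hy]

lemma isShiftMeasurable_dirac [AddCommGroup T] {E : Type*} [MeasurableSpace E] {Q : Measure E}
    [SFinite Q] {V : E → T → EReal} (hV : ∀ t, Measurable fun e => V e t) (b : T) :
    IsShiftMeasurable V (Measure.dirac b) Q where
  eval t := aemeasurable_dirac_prod b (hV (t - b))
  integrand := by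
    refine ⟨fun q => V q.2.2 (b - b), (hV (b - b)).comp (measurable_snd.comp measurable_snd), ?_⟩
    have h1 : ∀ᵐ q ∂((Measure.dirac b).prod ((Measure.dirac b).prod Q)), q.1 = b :=
      Measure.quasiMeasurePreserving_fst.ae (p := fun s => s = b) (by simp)
    have h2 : ∀ᵐ q ∂((Measure.dirac b).prod ((Measure.dirac b).prod Q)), q.2.1 = b :=
      (Measure.quasiMeasurePreserving_fst.comp Measure.quasiMeasurePreserving_snd).ae
        (p := fun s => s = b) (by simp)
    filter_upwards [h1, h2] with q hq1 hq2
    rw [hq1, hq2]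

end Dirac

end MaxStable

/-! ### The equivalence -/

-- The index set `T` covers `ℝ^d` with its Borel sets and `ℤ^d`, whose elements are added and
-- whose points are measurable.
theorem theorem2p5 {T : Type} [AddCommGroup T] [MeasurableSpace T] [MeasurableSingletonClass T]
    {Ω : Type u} {Ω₁ : Type v} [MeasurableSpace Ω] [MeasurableSpace Ω₁]
    (P : Measure Ω) [IsProbabilityMeasure P] (P₁ : Measure Ω₁) [IsProbabilityMeasure P₁]
    -- the spectral process
    (Z : Ω → PathSpace T) (hZ : Measurable Z)
    (hexp : ∀ t, ∫⁻ ω, EReal.exp (Z ω t) ∂P = 1)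
    (hfin : ∀ h, ∀ᵐ ω ∂P, Z ω h ≠ ⊥)
    -- the points and the independent copies of `Z` that define the max-stable process `ζ`
    (p : ℕ → Ω₁ → ℝ) (z : ℕ → Ω₁ → PathSpace T)
    (hpz : IsMarkedPoisson expIntensity (P.map Z) p z P₁)
    (ζ : Ω₁ → T → EReal) (hζ : ζ = maxProcess p (fun i ω => z i ω)) :
    List.TFAE [
      -- stationarity
      ∀ h : T, FddEq ζ P₁ (fun ω t => ζ ω (t - h)) P₁,
      -- the Dieker-Mikosch representation, for every realization `V` of `Ξ_0 Z` on `(E, Q)`,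
      -- whose independent copies are `V` evaluated at independent points `x i` with law `Q`
      ∀ (μ : Measure T) [SigmaFinite μ],
        AEMeasurable (fun q : T × Ω => Z q.2 q.1) (μ.prod P) →
        (∀ᵐ ω ∂P, 0 < ∫⁻ s, EReal.exp (Z ω s) ∂μ ∧ ∫⁻ s, EReal.exp (Z ω s) ∂μ < ∞) →
        ∀ {E Ω₂ : Type u} [MeasurableSpace E] [MeasurableSpace Ω₂]
          (Q : Measure E) [IsProbabilityMeasure Q] (P₂ : Measure Ω₂) [IsProbabilityMeasure P₂]
          (V : E → T → EReal) (q : ℕ → Ω₂ → ℝ × T) (x : ℕ → Ω₂ → E),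
          FddEq V Q (tiltedProcess Z 0) (tilt P Z 0) →
          IsShiftMeasurable V μ Q →
          IsMarkedPoisson (expIntensity.prod μ) Q q x P₂ →
          FddEq ζ P₁
            (maxProcess (fun i ω => (q i ω).1)
              (fun i => logNormalize μ (fun ω t => V (x i ω) (t - (q i ω).2)))) P₂,
      -- the tilt-shift formula
      ∀ Γ : PathSpace T → ℝ≥0, Measurable Γ →
        (∀ (f : PathSpace T) (c : ℝ), Γ (f.addConst c) = Γ f) →
        ∀ a h : T, ∫⁻ ω, EReal.exp (Z ω (a + h)) * (Γ (Z ω) : ℝ≥0∞) ∂P =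
          ∫⁻ ω, EReal.exp (Z ω a) * (Γ ((Z ω).lag h) : ℝ≥0∞) ∂P,
      -- tilting at `a + h` is tilting at `a` followed by the shift by `h`
      ∀ a h : T, FddEq (tiltedProcess Z (a + h)) (tilt P Z (a + h))
        (fun ω t => tiltedProcess Z a ω (t - h)) (tilt P Z a)] := by

  subst hζ
  have hprob : ∀ b, IsProbabilityMeasure (tilt P Z b) := fun b =>
    isProbabilityMeasure_tilt (hexp b)
  have hcdf := fun {n : ℕ} (t : Fin n → T) => hpz.aemeasurable_maxProcess_and_measure_le hZ t
  tfae_have 1 → 4 := fun H a h => by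
    refine fddEq_tiltedProcess_of_exponent hZ hexp hfin (fun n t => ?_) a
    exact (map_eq_map_iff_of_expNeg (hcdf t).1 (hcdf fun j => t j - h).1 (hcdf t).2
      (hcdf fun j => t j - h).2).1 (H h n t)
  tfae_have 4 → 3 := fun H Γ hΓ hinv a h =>
    tilt_shift_of_fddEq_tiltedProcess hZ hexp hfin (H a h) hΓ hinv
  tfae_have 3 → 4 := fun H a h => fddEq_tiltedProcess_of_tilt_shift hZ H a h
  tfae_have 4 → 2 := by
    intro H μ _ hZm hS E Ω₂ _ _ Q _ P₂ _ V q x hVZ hV hm n t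
    have hcdf₂ := hm.aemeasurable_shifted_and_measure_le hV t
    refine (map_eq_map_iff_of_expNeg (hcdf t).1 hcdf₂.1 (hcdf t).2 hcdf₂.2).2 fun c => ?_
    refine (lintegral_shift_eq_of_fddEq_tiltedProcess hZ hexp hfin (fun h => ?_) hZm hS hVZ hV
      t c).symm
    simpa using H 0 h
  tfae_have 2 → 1 := by
    intro H h n t
    have hV : ∀ t, Measurable fun ω => tiltedProcess Z 0 ω t := measurable_tiltedProcess hZ 0
    -- the representation for the unit mass at `b`
    have key : ∀ (b : T) (t : Fin n → T) (c : Fin n → EReal),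
        ∫⁻ ω, ⨆ j, EReal.exp (Z ω (t j) - c j) ∂P =
          ∫⁻ e, (⨆ j, EReal.exp (tiltedProcess Z 0 e (t j - b) - c j)) *
            (EReal.exp (tiltedProcess Z 0 e 0))⁻¹ ∂(tilt P Z 0) := by
      intro b t
      have hpm : Measurable fun ω i => p i ω :=
        measurable_pi_lambda _ hpz.poisson.measurable_point
      have : IsProbabilityMeasure (P₁.map fun ω i => p i ω) :=
        Measure.isProbabilityMeasure_map hpm.aemeasurable
      have hm := hpz.poisson.isMarkedPoisson_prod_infinitePi (tilt P Z 0) b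
      have hsh := isShiftMeasurable_dirac (Q := tilt P Z 0) hV b
      have hcdf₂ := hm.aemeasurable_shifted_and_measure_le hsh t
      have hrep := H (Measure.dirac b)
        (aemeasurable_dirac_prod b (measurable_eval_comp hZ b)) (by
          filter_upwards [hfin b] with ω hω
          rw [lintegral_dirac]
          exact ⟨by simpa [bot_lt_iff_ne_bot] using hω,
            by simpa [lt_top_iff_ne_top] using (Z ω).2.1 b⟩)
        (tilt P Z 0) _ (tiltedProcess Z 0) _ _ (fun _ _ => rfl) hsh hm n t
      intro c
      rw [(map_eq_map_iff_of_expNeg (hcdf t).1 hcdf₂.1 (hcdf t).2 hcdf₂.2).1 hrep c]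
      simp [lintegral_dirac]
    refine (map_eq_map_iff_of_expNeg (hcdf t).1 (hcdf fun j => t j - h).1 (hcdf t).2
      (hcdf fun j => t j - h).2).2 fun c => ?_
    rw [key h t c, key 0 (fun j => t j - h) c]
    simp
  tfae_finish
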